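/- All vector spaces are over $\mathbb{C}$. Let $n\ge 2$ and let $\mathfrak q=\mathfrak q(n)$ be the queer Lie superalgebra of block matrices $\left(\begin{smallmatrix}X&Y\\Y&X\end{smallmatrix}\right)$, $X,Y\in\mathrm{Mat}_n(\mathbb C)$ ($X$ is the even part, $Y$ the odd part), with the supercommutator. Let $\mathfrak h=\mathfrak h_{\bar0}\oplus\mathfrak h_{\bar1}$ (diagonal $X,Y$) be its Cartan subalgebra, $\mathfrak n^+$ (strictly upper triangular $X,Y$) its positive part, and, for $1\le i\le n$ resp. $1\le i\le n-1$, let $k_i,f_i\in\mathfrak q_{\bar 0}$ be the elements with $X=E_{i,i}$ resp. $X=E_{i+1,i}$, and $h_i=k_i-k_{i+1}$. Let $\epsilon_i\in\mathfrak h_{\bar0}^*$ be the basis dual to $(k_i)$ and $Q^+=\sum_{i=1}^{n-1}\mathbb Z_{\ge0}(\epsilon_i-\epsilon_{i+1})$. Let $\Lambda^+$ be the set of $\lambda=\sum_i\lambda_i\epsilon_i$ such that, for all $i\le n-1$, $\lambda_i-\lambda_{i+1}\in\mathbb Z_{\ge0}$, and $\lambda_i=\lambda_{i+1}$ implies $\lambda_i=\lambda_{i+1}=0$.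 Let $A$ be a commutative associative unital algebra; $\mathfrak q\otimes A$ has the bracket $[x\otimes a,y\otimes b]=[x,y]\otimes ab$ and contains the image $\mathfrak q\otimes 1$ of $\mathfrak q$, through which weight spaces $M_\mu=\{m: hm=\mu(h)m\ \forall h\in\mathfrak h_{\bar0}\}$ of $\mathfrak q\otimes A$-modules are formed. Modules are $\mathbb Z/2$-graded and homomorphisms are even. Let $\lambda\in\Lambda^+$ and let $L(\lambda)$ be any irreducible highest weight $\mathfrak q$-module of highest weight $\lambda$ (it is unique up to the parity change $\Pi$, and so are the modules built from it; the statement holds for each choice). Let $\bar L(\lambda)$ be the $\mathfrak q$-module generated by the $\mathfrak h$-module $L(\lambda)_\lambda$ with defining relations $\mathfrak n^+k=0$, $hk=\lambda(h)k$, $f_i^{\lambda(h_i)+1}k=0$ for all $k\in L(\lambda)_\lambda$, $h\in\mathfrak h_{\bar0}$, $1\le i\le n-1$. Let $P=\mathbf U(\mathfrak q\otimes A)\otimes_{\mathbf U(\mathfrak q)}\bar L(\lambda)$, and let $$W_A(\lambda)=P\Big/\sum_{\mu\notin\lambda-Q^+}\mathbf U(\mathfrak q\otimes A)P_\mu$$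 be the global Weyl module. For $k\in L(\lambda)_\lambda$ let $w_k\in W_A(\lambda)$ be the image of $1\otimes k$. **Proposition.** The $\mathfrak q\otimes A$-module $W_A(\lambda)$ is generated by its weight space $W_A(\lambda)_\lambda$, with defining relations $$(\mathfrak n^+\otimes A)w=0,\qquad hw=\lambda(h)w\quad(h\in\mathfrak h_{\bar0}),\qquad f_i^{\lambda(h_i)+1}w=0\quad(1\le i\le n-1).\tag{$*$}$$ That is: 1. $W_A(\lambda)$ is generated by $W_A(\lambda)_\lambda$, and $(*)$ holds for every $w\in W_A(\lambda)_\lambda$. 2. The map $k\mapsto w_k$ is an even homomorphism of $\mathfrak h$-modules $L(\lambda)_\lambda\to W_A(\lambda)_\lambda$, the $w_k$ generate $W_A(\lambda)$, and $(*)$ for $w=w_k$ are the defining relations: for every $\mathfrak q\otimes A$-module $M$ and every even homomorphism of $\mathfrak h$-modules $\varphi:L(\lambda)_\lambda\to M$ such that all $\varphi(k)$ satisfy $(*)$, there is a unique homomorphism of $\mathfrak q\otimes A$-modules $\Phi:W_A(\lambda)\to M$ with $\Phi(w_k)=\varphi(k)$ for all $k$. 3. The same holds with the whole weight space as generating space: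 for every $\mathfrak q\otimes A$-module $M$ and every even homomorphism of $\mathfrak h\otimes A$-modules $\varphi:W_A(\lambda)_\lambda\to M$ such that all $\varphi(w)$ satisfy $(*)$, there is a unique homomorphism of $\mathfrak q\otimes A$-modules $\Phi:W_A(\lambda)\to M$ that extends $\varphi$. -/

import Mathlib

open scoped TensorProduct

universe u v w

noncomputable section

namespace QueerWeyl

/-! ### Supervector spaces -/

/-- The sign `(-1)^{ij}` for parities `i, j`. -/
def superSign (i j : ZMod 2) : ℂ := if i = 1 ∧ j = 1 then -1 else 1

/-- The sign `(-1)^i` for a parity `i`. -/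
def paritySign (i : ZMod 2) : ℂ := if i = 0 then 1 else -1

/-- A supervector space: a complex vector space with a decomposition `V = V₀ ⊕ V₁`. -/
class SuperSpace (V : Type u) [AddCommGroup V] [Module ℂ V] where
  /-- the homogeneous component of a given parity -/
  gr : ZMod 2 → Submodule ℂ V
  isCompl_gr : IsCompl (gr 0) (gr 1)

open SuperSpace

theorem zmod_cases : ∀ i : ZMod 2, i = 0 ∨ i = 1 := by decide

theorem one_add_one_zmod : (1 : ZMod 2) + 1 = 0 := by decide

theorem paritySign_add (i j : ZMod 2) : paritySign (i + j) = paritySign i * paritySign j := by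
  rcases zmod_cases i with rfl | rfl <;> rcases zmod_cases j with rfl | rfl <;>
    simp [paritySign, one_add_one_zmod]

theorem paritySign_mul_self (i : ZMod 2) : paritySign i * paritySign i = 1 := by
  rcases zmod_cases i with rfl | rfl <;> simp [paritySign]

section Parity

variable {V : Type u} [AddCommGroup V] [Module ℂ V]

theorem eq_zero_of_eq_neg {x : V} (h : x = -x) : x = 0 := by
  have h2 : (2 : ℂ) • x = 0 := by
    rw [two_smul]; nth_rewrite 1 [h]; simp
  simpa using h2

/-- The grading attached to an involution `s`: the even part is the `1`-eigenspace and the odd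
part the `(-1)`-eigenspace. -/
@[reducible]
def SuperSpace.ofInvolution (s : V →ₗ[ℂ] V) (hs : ∀ x, s (s x) = x) : SuperSpace V where
  gr i := LinearMap.ker (s - paritySign i • LinearMap.id)
  isCompl_gr := by
    constructor
    · rw [Submodule.disjoint_def]
      intro x hx hy
      simp only [paritySign, LinearMap.mem_ker, LinearMap.sub_apply,
        LinearMap.id_apply, sub_eq_zero, if_true, one_smul, one_ne_zero, if_false,
        neg_smul] at hx hy
      exact eq_zero_of_eq_neg (hx.symm.trans hy)
    · rw [codisjoint_iff, eq_top_iff]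
      intro x _
      rw [Submodule.mem_sup]
      refine ⟨(2⁻¹ : ℂ) • (x + s x), ?_, (2⁻¹ : ℂ) • (x - s x), ?_, ?_⟩
      · simp [paritySign, hs, add_comm]
      · simp [paritySign, hs]
      · rw [← smul_add]
        have : x + s x + (x - s x) = (2 : ℂ) • x := by rw [two_smul]; abel
        rw [this, smul_smul]; norm_num

variable [SuperSpace V]

variable (V) in
/-- The parity involution `v₀ + v₁ ↦ v₀ - v₁` of a supervector space. -/
def parity : V →ₗ[ℂ] V :=
  (gr 0).projection (gr 1) isCompl_gr - (gr 1).projection (gr 0) isCompl_gr.symm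

theorem parity_of_mem {i : ZMod 2} {x : V} (hx : x ∈ (gr i : Submodule ℂ V)) :
    parity V x = paritySign i • x := by
  rcases zmod_cases i with rfl | rfl
  · simp [parity, paritySign, Submodule.projection_apply_of_mem_left _ hx,
      (Submodule.projection_apply_eq_zero_iff _).2 hx]
  · simp [parity, paritySign, Submodule.projection_apply_of_mem_left _ hx,
      (Submodule.projection_apply_eq_zero_iff _).2 hx]

theorem exists_homogeneous (x : V) :
    ∃ a ∈ (gr 0 : Submodule ℂ V), ∃ b ∈ (gr 1 : Submodule ℂ V), a + b = x := by
  have h : x ∈ (gr 0 : Submodule ℂ V) ⊔ gr 1 := by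
    rw [isCompl_gr.sup_eq_top]; trivial
  exact Submodule.mem_sup.1 h

/-- A property that is additive and holds for homogeneous elements holds for all elements. -/
theorem homogeneous_induction {p : V → Prop} (h : ∀ i, ∀ x ∈ (gr i : Submodule ℂ V), p x)
    (hadd : ∀ x y, p x → p y → p (x + y)) (x : V) : p x := by
  obtain ⟨a, ha, b, hb, rfl⟩ := exists_homogeneous x
  exact hadd _ _ (h 0 a ha) (h 1 b hb)

theorem parity_parity (x : V) : parity V (parity V x) = x := by
  induction x using homogeneous_induction with
  | h i x hx => rw [parity_of_mem hx, map_smul, parity_of_mem hx, smul_smul,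
      paritySign_mul_self, one_smul]
  | hadd x y hx hy => simp [hx, hy]

theorem mem_gr_iff {i : ZMod 2} {x : V} :
    x ∈ (gr i : Submodule ℂ V) ↔ parity V x = paritySign i • x := by
  refine ⟨parity_of_mem, fun h => ?_⟩
  obtain ⟨a, ha, b, hb, rfl⟩ := exists_homogeneous x
  rw [map_add, parity_of_mem ha, parity_of_mem hb] at h
  rcases zmod_cases i with rfl | rfl
  · have : b = 0 := by
      simp only [paritySign, if_true, one_smul, one_ne_zero, if_false, neg_smul] at h
      exact (eq_zero_of_eq_neg (add_left_cancel h).symm)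
    simpa [this] using ha
  · have : a = 0 := by
      simp only [paritySign, if_true, one_smul, one_ne_zero, if_false, neg_smul, smul_add] at h
      exact (eq_zero_of_eq_neg (add_right_cancel h))
    simpa [this] using hb

end Parity

theorem parity_ofInvolution {V : Type u} [AddCommGroup V] [Module ℂ V] (s : V →ₗ[ℂ] V)
    (hs : ∀ x, s (s x) = x) (x : V) :
    letI := SuperSpace.ofInvolution s hs
    parity V x = s x := by
  let _ := SuperSpace.ofInvolution s hs
  induction x using homogeneous_induction with
  | h i x hx =>
    rw [parity_of_mem hx]
    have h : x ∈ LinearMap.ker (s - paritySign i • LinearMap.id) := hx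
    rw [LinearMap.mem_ker, LinearMap.sub_apply, sub_eq_zero] at h
    exact h.symm
  | hadd x y hx hy => simp [hx, hy]

/-- A linear map of supervector spaces is even if it preserves parity. -/
def IsEvenMap {V : Type u} {W : Type v} [AddCommGroup V] [Module ℂ V] [SuperSpace V]
    [AddCommGroup W] [Module ℂ W] [SuperSpace W] (f : V → W) : Prop :=
  ∀ i, ∀ x ∈ (gr i : Submodule ℂ V), f x ∈ (gr i : Submodule ℂ W)

/-- An additive subgroup is graded if it contains the homogeneous components of its elements. -/
def IsGraded {V : Type u} [AddCommGroup V] [Module ℂ V] [SuperSpace V]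
    (N : AddSubgroup V) : Prop :=
  ∀ a ∈ (gr 0 : Submodule ℂ V), ∀ b ∈ (gr 1 : Submodule ℂ V), a + b ∈ N → a ∈ N ∧ b ∈ N

/-! ### Lie superalgebras -/

/-- A Lie superalgebra over `ℂ`. -/
class LieSuperalgebra (g : Type u) [AddCommGroup g] [Module ℂ g] extends SuperSpace g where
  /-- the superbracket -/
  bracket : g →ₗ[ℂ] g →ₗ[ℂ] g
  bracket_mem : ∀ {i j : ZMod 2} {x y : g}, x ∈ gr i → y ∈ gr j → bracket x y ∈ gr (i + j)
  bracket_skew : ∀ {i j : ZMod 2} {x y : g}, x ∈ gr i → y ∈ gr j →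
    bracket x y = -(superSign i j • bracket y x)
  jacobi : ∀ {i j : ZMod 2} {x y : g}, x ∈ gr i → y ∈ gr j → ∀ z : g,
    bracket x (bracket y z) =
      bracket (bracket x y) z + superSign i j • bracket y (bracket x z)

open LieSuperalgebra

/-- The tensor product `g ⊗ A` of a Lie superalgebra and a commutative algebra, with
`(g ⊗ A)ⱼ = gⱼ ⊗ A` and `[x ⊗ a, y ⊗ b] = [x, y] ⊗ ab`. -/
instance currentAlgebra (g : Type u) [AddCommGroup g] [Module ℂ g] [LieSuperalgebra g]
    (A : Type v) [CommRing A] [Algebra ℂ A] : LieSuperalgebra (g ⊗[ℂ] A) where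
  gr i := LinearMap.range ((gr i : Submodule ℂ g).subtype.rTensor A)
  isCompl_gr := by
    have key : ∀ (i : ZMod 2) (x : g ⊗[ℂ] A),
        x ∈ LinearMap.range ((gr i : Submodule ℂ g).subtype.rTensor A) →
        (parity g).rTensor A x = paritySign i • x := by
      rintro i _ ⟨y, rfl⟩
      induction y with
      | zero => simp
      | tmul a b => simp [parity_of_mem a.2, TensorProduct.smul_tmul']
      | add a b ha hb => simp [ha, hb]
    constructor
    · rw [Submodule.disjoint_def]
      intro x hx hy
      have h0 := key 0 x hx
      have h1 := key 1 x hy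
      simp only [paritySign, if_true, one_smul, one_ne_zero, if_false, neg_smul] at h0 h1
      exact eq_zero_of_eq_neg (h0.symm.trans h1)
    · rw [codisjoint_iff, eq_top_iff]
      intro x _
      induction x with
      | zero => exact zero_mem _
      | tmul a b =>
        obtain ⟨c, hc, d, hd, rfl⟩ := exists_homogeneous a
        rw [TensorProduct.add_tmul]
        exact Submodule.add_mem_sup ⟨(⟨c, hc⟩ : (gr 0 : Submodule ℂ g)) ⊗ₜ b, by simp⟩
          ⟨(⟨d, hd⟩ : (gr 1 : Submodule ℂ g)) ⊗ₜ b, by simp⟩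
      | add a b ha hb => exact add_mem (ha trivial) (hb trivial)
  bracket := TensorProduct.map₂ bracket (LinearMap.mul ℂ A)
  bracket_mem := by
    rintro i j _ _ ⟨x, rfl⟩ ⟨y, rfl⟩
    induction x with
    | zero => simp
    | add a b ha hb => simpa using add_mem ha hb
    | tmul a b =>
      induction y with
      | zero => simp
      | add a b ha hb => simpa using add_mem ha hb
      | tmul c d =>
        exact ⟨(⟨bracket (a : g) (c : g), bracket_mem a.2 c.2⟩ :
          (gr (i + j) : Submodule ℂ g)) ⊗ₜ (b * d), by simp⟩
  bracket_skew := by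
    rintro i j _ _ ⟨x, rfl⟩ ⟨y, rfl⟩
    induction x with
    | zero => simp
    | add a b ha hb => simp only [map_add, LinearMap.add_apply, smul_add, neg_add, ha, hb]
    | tmul a b =>
      induction y with
      | zero => simp
      | add a b ha hb => simp only [map_add, LinearMap.add_apply, smul_add, neg_add, ha, hb]
      | tmul c d =>
        simp only [LinearMap.rTensor_tmul, Submodule.subtype_apply, TensorProduct.map₂_apply_tmul,
          TensorProduct.map_tmul, LinearMap.mul_apply']
        rw [bracket_skew a.2 c.2, TensorProduct.neg_tmul, mul_comm, TensorProduct.smul_tmul']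
  jacobi := by
    rintro i j _ _ ⟨x, rfl⟩ ⟨y, rfl⟩ z
    induction x with
    | zero => simp
    | add a b ha hb =>
      simp only [map_add, LinearMap.add_apply, smul_add, ha, hb]; abel
    | tmul a b =>
      induction y with
      | zero => simp
      | add a b ha hb => 
        simp only [map_add, LinearMap.add_apply, smul_add, ha, hb]; abel
      | tmul c d =>
        induction z with
        | zero => simp
        | add a b ha hb =>
          simp only [map_add, smul_add, ha, hb]; abel
        | tmul e f =>
          simp only [LinearMap.rTensor_tmul, Submodule.subtype_apply,
            TensorProduct.map₂_apply_tmul, TensorProduct.map_tmul, LinearMap.mul_apply']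
          rw [jacobi a.2 c.2, TensorProduct.add_tmul, TensorProduct.smul_tmul', mul_assoc,
            mul_left_comm d b f]

/-! ### The queer Lie superalgebra -/

/-- The underlying space of `q(n)`: the complex `2n × 2n` block matrices
`(X | Y ; Y | X)`. -/
def queerSubmodule (n : ℕ) : Submodule ℂ (Matrix (Fin n ⊕ Fin n) (Fin n ⊕ Fin n) ℂ) where
  carrier := {M | ∃ X Y : Matrix (Fin n) (Fin n) ℂ, M = Matrix.fromBlocks X Y Y X}
  zero_mem' := ⟨0, 0, by simp⟩
  add_mem' := by
    rintro _ _ ⟨X, Y, rfl⟩ ⟨X', Y', rfl⟩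
    exact ⟨X + X', Y + Y', by simp [Matrix.fromBlocks_add]⟩
  smul_mem' := by
    rintro c _ ⟨X, Y, rfl⟩
    exact ⟨c • X, c • Y, by simp [Matrix.fromBlocks_smul]⟩

/-- The queer Lie superalgebra `q(n)`. -/
abbrev Queer (n : ℕ) : Type := queerSubmodule n

namespace Queer

variable {n : ℕ}

/-- The matrix `(X | Y ; Y | X)` as an element of `q(n)`. -/
def mk (X Y : Matrix (Fin n) (Fin n) ℂ) : Queer n := ⟨Matrix.fromBlocks X Y Y X, X, Y, rfl⟩

/-- The diagonal block `X` of `(X | Y ; Y | X)`. -/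
def evenBlock : Queer n →ₗ[ℂ] Matrix (Fin n) (Fin n) ℂ where
  toFun M := M.1.toBlocks₁₁
  map_add' _ _ := rfl
  map_smul' _ _ := rfl

/-- The off-diagonal block `Y` of `(X | Y ; Y | X)`. -/
def oddBlock : Queer n →ₗ[ℂ] Matrix (Fin n) (Fin n) ℂ where
  toFun M := M.1.toBlocks₁₂
  map_add' _ _ := rfl
  map_smul' _ _ := rfl

@[simp] theorem evenBlock_mk (X Y : Matrix (Fin n) (Fin n) ℂ) : evenBlock (mk X Y) = X := rfl

@[simp] theorem oddBlock_mk (X Y : Matrix (Fin n) (Fin n) ℂ) : oddBlock (mk X Y) = Y := rfl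

theorem mk_eta (M : Queer n) : mk (evenBlock M) (oddBlock M) = M := by
  obtain ⟨_, X, Y, rfl⟩ := M; rfl

theorem ext_blocks {M N : Queer n} (h : evenBlock M = evenBlock N)
    (h' : oddBlock M = oddBlock N) : M = N := by
  rw [← mk_eta M, ← mk_eta N, h, h']

/-- The `ℤ/2`-grading of `q(n)`: block-diagonal matrices are even, block-antidiagonal matrices
are odd. -/
instance superSpace (n : ℕ) : SuperSpace (Queer n) where
  gr i := if i = 0 then LinearMap.ker oddBlock else LinearMap.ker evenBlock
  isCompl_gr := by
    constructor
    · rw [Submodule.disjoint_def]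
      intro x hx hy
      simp only [if_true, one_ne_zero, if_false, LinearMap.mem_ker] at hx hy
      exact ext_blocks (by simpa using hy) (by simpa using hx)
    · rw [codisjoint_iff, eq_top_iff]
      intro x _
      rw [Submodule.mem_sup]
      exact ⟨mk (evenBlock x) 0, by simp, mk 0 (oddBlock x), by simp,
        ext_blocks (by simp) (by simp)⟩

/-- The superbracket of `q(n) ⊆ gl(n|n)`. For homogeneous `M, N` it is the supercommutator
`MN - (-1)^{|M||N|} NM` of matrices, see `coe_bracket`. -/
def superBracket : Queer n →ₗ[ℂ] Queer n →ₗ[ℂ] Queer n :=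
  LinearMap.mk₂ ℂ
    (fun M N => mk
      (evenBlock M * evenBlock N - evenBlock N * evenBlock M
        + oddBlock M * oddBlock N + oddBlock N * oddBlock M)
      (evenBlock M * oddBlock N - oddBlock N * evenBlock M
        + oddBlock M * evenBlock N - evenBlock N * oddBlock M))
    (fun _ _ _ => ext_blocks (by simp; noncomm_ring) (by simp; noncomm_ring))
    (fun _ _ _ => ext_blocks (by simp [smul_sub, smul_add]) (by simp [smul_sub, smul_add]))
    (fun _ _ _ => ext_blocks (by simp; noncomm_ring) (by simp; noncomm_ring))
    (fun _ _ _ => ext_blocks (by simp [smul_sub, smul_add]) (by simp [smul_sub, smul_add]))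

@[simp] theorem evenBlock_superBracket (M N : Queer n) : evenBlock (superBracket M N) =
    evenBlock M * evenBlock N - evenBlock N * evenBlock M
        + oddBlock M * oddBlock N + oddBlock N * oddBlock M := rfl

@[simp] theorem oddBlock_superBracket (M N : Queer n) : oddBlock (superBracket M N) =
    evenBlock M * oddBlock N - oddBlock N * evenBlock M
        + oddBlock M * evenBlock N - evenBlock N * oddBlock M := rfl

theorem coe_bracket {i j : ZMod 2} {M N : Queer n} (hM : M ∈ (gr i : Submodule ℂ (Queer n)))
    (hN : N ∈ (gr j : Submodule ℂ (Queer n))) :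
    (superBracket M N).1 = M.1 * N.1 - superSign i j • (N.1 * M.1) := by
  obtain ⟨X, Y, rfl⟩ : ∃ X Y, M = mk X Y := ⟨_, _, (mk_eta M).symm⟩
  obtain ⟨X', Y', rfl⟩ : ∃ X Y, N = mk X Y := ⟨_, _, (mk_eta N).symm⟩
  rw [← mk_eta (superBracket _ _)]
  rcases zmod_cases i with rfl | rfl <;> rcases zmod_cases j with rfl | rfl <;>
    simp only [gr, if_true, one_ne_zero, if_false, LinearMap.mem_ker, evenBlock_mk,
      oddBlock_mk] at hM hN <;> subst hM hN <;>
    rw [evenBlock_superBracket, oddBlock_superBracket] <;>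
    simp only [evenBlock_mk, oddBlock_mk] <;>
    simp [mk, superSign, Matrix.fromBlocks_multiply, sub_eq_add_neg,
      Matrix.fromBlocks_add, Matrix.fromBlocks_neg]

instance lieSuperalgebra (n : ℕ) : LieSuperalgebra (Queer n) where
  bracket := superBracket
  bracket_mem := by
    intro i j M N hM hN
    rcases zmod_cases i with rfl | rfl <;> rcases zmod_cases j with rfl | rfl <;>
    simp only [gr, if_true, one_ne_zero, if_false, LinearMap.mem_ker] at hM hN <;>
    simp [gr, hM, hN, one_add_one_zmod]
  bracket_skew := by
    intro i j M N hM hN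
    rcases zmod_cases i with rfl | rfl <;> rcases zmod_cases j with rfl | rfl <;>
    simp only [gr, if_true, one_ne_zero, if_false, LinearMap.mem_ker] at hM hN <;>
    exact ext_blocks (by simp [hM, hN, superSign, add_comm])
      (by simp [hM, hN, superSign, add_comm])
  jacobi := by
    intro i j M N hM hN Z
    rcases zmod_cases i with rfl | rfl <;> rcases zmod_cases j with rfl | rfl <;>
    simp only [gr, if_true, one_ne_zero, if_false, LinearMap.mem_ker] at hM hN <;>
    exact ext_blocks (by simp [hM, hN, superSign]; noncomm_ring)
      (by simp [hM, hN, superSign]; noncomm_ring)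

end Queer

/-! ### Universal enveloping superalgebras -/

section Enveloping

variable (g : Type u) [AddCommGroup g] [Module ℂ g] [LieSuperalgebra g]

/-- The defining relations `x y - (-1)^{|x||y|} y x = [x, y]` of the universal enveloping
superalgebra. -/
inductive EnvRel : TensorAlgebra ℂ g → TensorAlgebra ℂ g → Prop
  | super_comm {i j : ZMod 2} {x y : g} (hx : x ∈ (gr i : Submodule ℂ g))
      (hy : y ∈ (gr j : Submodule ℂ g)) :
      EnvRel (TensorAlgebra.ι ℂ x * TensorAlgebra.ι ℂ y)
        (TensorAlgebra.ι ℂ (bracket x y) +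
          superSign i j • (TensorAlgebra.ι ℂ y * TensorAlgebra.ι ℂ x))

/-- The universal enveloping superalgebra `U(g)`. -/
def Env : Type u := RingQuot (EnvRel g)

instance : Ring (Env g) := inferInstanceAs (Ring (RingQuot (EnvRel g)))

instance : Algebra ℂ (Env g) := inferInstanceAs (Algebra ℂ (RingQuot (EnvRel g)))

namespace Env

variable {g}

/-- The canonical map `g → U(g)`. -/
def ι : g →ₗ[ℂ] Env g :=
  (RingQuot.mkAlgHom ℂ (EnvRel g)).toLinearMap ∘ₗ TensorAlgebra.ι ℂ

theorem ι_mul_ι {i j : ZMod 2} {x y : g} (hx : x ∈ (gr i : Submodule ℂ g))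
    (hy : y ∈ (gr j : Submodule ℂ g)) :
    (ι x * ι y : Env g) = ι (bracket x y) + superSign i j • (ι y * ι x) := by
  have h := RingQuot.mkAlgHom_rel ℂ (EnvRel.super_comm hx hy)
  rw [map_mul, map_add, map_smul, map_mul] at h
  exact h

/-- The universal property of `U(g)`. -/
def lift {B : Type v} [Ring B] [Algebra ℂ B] (f : g →ₗ[ℂ] B)
    (hf : ∀ {i j : ZMod 2} {x y : g}, x ∈ (gr i : Submodule ℂ g) → y ∈ (gr j : Submodule ℂ g) →
      f x * f y = f (bracket x y) + superSign i j • (f y * f x)) : Env g →ₐ[ℂ] B :=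
  RingQuot.liftAlgHom ℂ ⟨TensorAlgebra.lift ℂ f, by
    rintro _ _ ⟨hx, hy⟩
    simpa using hf hx hy⟩

@[simp] theorem lift_ι {B : Type v} [Ring B] [Algebra ℂ B] (f : g →ₗ[ℂ] B)
    (hf : ∀ {i j : ZMod 2} {x y : g}, x ∈ (gr i : Submodule ℂ g) → y ∈ (gr j : Submodule ℂ g) →
      f x * f y = f (bracket x y) + superSign i j • (f y * f x)) (x : g) :
    lift f hf (ι x) = f x := by
  have h := RingQuot.liftAlgHom_mkAlgHom_apply ℂ (TensorAlgebra.lift ℂ f) (s := EnvRel g) (by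
    rintro _ _ ⟨hx, hy⟩
    simpa using hf hx hy) (TensorAlgebra.ι ℂ x)
  rw [TensorAlgebra.lift_ι_apply] at h
  exact h

theorem algHom_ext {B : Type v} [Ring B] [Algebra ℂ B] {f f' : Env g →ₐ[ℂ] B}
    (h : ∀ x, f (ι x) = f' (ι x)) : f = f' := by
  apply RingQuot.ringQuot_ext'
  apply TensorAlgebra.hom_ext
  ext x
  exact h x

theorem parityHom_aux {i j : ZMod 2} {x y : g} (hx : x ∈ (gr i : Submodule ℂ g))
    (hy : y ∈ (gr j : Submodule ℂ g)) :
    (ι ∘ₗ parity g : g →ₗ[ℂ] Env g) x * (ι ∘ₗ parity g : g →ₗ[ℂ] Env g) y =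
      (ι ∘ₗ parity g : g →ₗ[ℂ] Env g) (bracket x y) +
        superSign i j •
          ((ι ∘ₗ parity g : g →ₗ[ℂ] Env g) y * (ι ∘ₗ parity g : g →ₗ[ℂ] Env g) x) := by
  have e : ((paritySign i * paritySign j) • (ι x * ι y) : Env g) =
      (paritySign i * paritySign j) • (ι (bracket x y) + superSign i j • (ι y * ι x)) := by
    rw [ι_mul_ι hx hy]
  simp only [LinearMap.comp_apply, parity_of_mem hx, parity_of_mem hy,
    parity_of_mem (bracket_mem hx hy), map_smul, smul_mul_smul_comm, paritySign_add]
  rw [e, smul_add, smul_smul, smul_smul]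
  congr 2
  ring

/-- The parity automorphism of `U(g)`, extending the parity involution of `g`. -/
def parityHom : Env g →ₐ[ℂ] Env g := lift (ι ∘ₗ parity g) parityHom_aux

@[simp] theorem parityHom_ι (x : g) : parityHom (ι x) = ι (parity g x) :=
  lift_ι (ι ∘ₗ parity g) parityHom_aux x

theorem parityHom_parityHom (a : Env g) : parityHom (parityHom a) = a := by
  have h : (parityHom.comp parityHom : Env g →ₐ[ℂ] Env g) = AlgHom.id ℂ (Env g) :=
    algHom_ext (fun x => by simp [parity_parity])
  exact DFunLike.congr_fun h a

/-- The `ℤ/2`-grading of `U(g)`, for which products of `r` odd and any number of even elements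
of `g` have parity `r`. -/
instance : SuperSpace (Env g) :=
  SuperSpace.ofInvolution parityHom.toLinearMap parityHom_parityHom

theorem parity_apply (a : Env g) : parity (Env g) a = parityHom a :=
  parity_ofInvolution parityHom.toLinearMap parityHom_parityHom a

theorem map_aux {k : Type v} [AddCommGroup k] [Module ℂ k] [LieSuperalgebra k] (f : g →ₗ[ℂ] k)
    (hf : IsEvenMap f) (hf' : ∀ x y, f (bracket x y) = bracket (f x) (f y)) {i j : ZMod 2}
    {x y : g} (hx : x ∈ (gr i : Submodule ℂ g)) (hy : y ∈ (gr j : Submodule ℂ g)) :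
    (ι ∘ₗ f : g →ₗ[ℂ] Env k) x * (ι ∘ₗ f : g →ₗ[ℂ] Env k) y =
      (ι ∘ₗ f : g →ₗ[ℂ] Env k) (bracket x y) +
        superSign i j • ((ι ∘ₗ f : g →ₗ[ℂ] Env k) y * (ι ∘ₗ f : g →ₗ[ℂ] Env k) x) := by
  simpa [hf'] using ι_mul_ι (hf i x hx) (hf j y hy)

/-- The homomorphism `U(g) → U(k)` induced by a homomorphism `g → k` of Lie superalgebras. -/
def map {k : Type v} [AddCommGroup k] [Module ℂ k] [LieSuperalgebra k] (f : g →ₗ[ℂ] k)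
    (hf : IsEvenMap f) (hf' : ∀ x y, f (bracket x y) = bracket (f x) (f y)) :
    Env g →ₐ[ℂ] Env k :=
  lift (ι ∘ₗ f) (map_aux f hf hf')

theorem map_ι {k : Type v} [AddCommGroup k] [Module ℂ k] [LieSuperalgebra k] (f : g →ₗ[ℂ] k)
    (hf : IsEvenMap f) (hf' : ∀ x y, f (bracket x y) = bracket (f x) (f y)) (x : g) :
    map f hf hf' (ι x) = ι (f x) :=
  lift_ι (ι ∘ₗ f) (map_aux f hf hf') x

end Env

end Enveloping

/-! ### Supermodules -/

section Modules

variable (g : Type u) [AddCommGroup g] [Module ℂ g] [LieSuperalgebra g]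

/-- A left `U(g)`-module with a `ℤ/2`-grading is a supermodule if `gᵢ Mⱼ ⊆ Mᵢ₊ⱼ`. -/
class IsSuperModule (M : Type v) [AddCommGroup M] [Module ℂ M] [Module (Env g) M]
    [IsScalarTower ℂ (Env g) M] [SuperSpace M] : Prop where
  smul_mem : ∀ {i j : ZMod 2} {x : g} {m : M}, x ∈ (gr i : Submodule ℂ g) →
    m ∈ (gr j : Submodule ℂ M) → Env.ι x • m ∈ (gr (i + j) : Submodule ℂ M)

variable {g}

theorem parity_ι_smul {M : Type v} [AddCommGroup M] [Module ℂ M] [Module (Env g) M]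
    [IsScalarTower ℂ (Env g) M] [SuperSpace M] [IsSuperModule g M] (x : g) (m : M) :
    parity M (Env.ι x • m) = Env.ι (parity g x) • parity M m := by
  induction x using homogeneous_induction with
  | hadd x y hx hy => simp [add_smul, hx, hy]
  | h i x hx =>
    induction m using homogeneous_induction with
    | hadd m m' hm hm' => simp [smul_add, hm, hm']
    | h j m hm =>
      rw [parity_of_mem (IsSuperModule.smul_mem hx hm), parity_of_mem hx, parity_of_mem hm,
        map_smul, paritySign_add, smul_assoc, smul_comm (Env.ι x), smul_smul]

theorem isSuperModule_of_parity {M : Type v} [AddCommGroup M] [Module ℂ M] [Module (Env g) M]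
    [IsScalarTower ℂ (Env g) M] [SuperSpace M]
    (h : ∀ (x : g) (m : M), parity M (Env.ι x • m) = Env.ι (parity g x) • parity M m) :
    IsSuperModule g M where
  smul_mem := by
    intro i j x m hx hm
    rw [mem_gr_iff, h, parity_of_mem hx, parity_of_mem hm, map_smul, paritySign_add,
      smul_assoc, smul_comm (Env.ι x), smul_smul]

theorem parity_smul {M : Type v} [AddCommGroup M] [Module ℂ M] [Module (Env g) M]
    [IsScalarTower ℂ (Env g) M] [SuperSpace M] [IsSuperModule g M] (a : Env g) (m : M) :
    parity M (a • m) = Env.parityHom a • parity M m := by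
  let s : Module.End ℂ M := parity M
  have hs : ∀ m, s (s m) = m := parity_parity
  let ρ : Env g →ₐ[ℂ] Module.End ℂ M := Algebra.lsmul ℂ ℂ M
  let c : Module.End ℂ M →ₐ[ℂ] Module.End ℂ M :=
    AlgHom.ofLinearMap (LinearMap.mulLeft ℂ s ∘ₗ LinearMap.mulRight ℂ s)
      (by ext m; simp [hs]) (by intro a b; ext m; simp [hs])
  have key : c.comp ρ = ρ.comp Env.parityHom := by
    apply Env.algHom_ext
    intro x
    ext m
    simp only [AlgHom.comp_apply, Env.parityHom_ι]
    change s (Env.ι x • s m) = Env.ι (parity g x) • m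
    rw [parity_ι_smul]
    congr 1
    exact hs m
  have h := DFunLike.congr_fun (DFunLike.congr_fun key a) (s m)
  change s (a • s (s m)) = _ at h
  rw [hs] at h
  exact h

end Modules

/-! ### Free modules, and quotients by graded submodules -/

section Free

variable (g : Type u) [AddCommGroup g] [Module ℂ g] [LieSuperalgebra g]
variable (V : Type v) [AddCommGroup V] [Module ℂ V] [SuperSpace V]

/-- The free `U(g)`-supermodule `U(g) ⊗ V` on a supervector space `V`. -/
abbrev FreeMod : Type (max u v) := Env g ⊗[ℂ] V

theorem freeMod_involution (x : FreeMod g V) :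
    TensorProduct.map (parity (Env g)) (parity V)
      (TensorProduct.map (parity (Env g)) (parity V) x) = x := by
  induction x using TensorProduct.induction_on with
  | zero => simp
  | tmul a b => simp [parity_parity]
  | add a b ha hb => simp [ha, hb]

/-- The grading of `U(g) ⊗ V` as a tensor product of supervector spaces: its parity involution is
the tensor product of the parity involutions of the factors. -/
instance : SuperSpace (FreeMod g V) :=
  SuperSpace.ofInvolution (TensorProduct.map (parity (Env g)) (parity V))
    (freeMod_involution g V)

variable {g V}

theorem parity_tmul (a : Env g) (v : V) :
    parity (FreeMod g V) (a ⊗ₜ v) = Env.parityHom a ⊗ₜ parity V v := by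
  rw [← Env.parity_apply]
  exact parity_ofInvolution (TensorProduct.map (parity (Env g)) (parity V))
    (freeMod_involution g V) (a ⊗ₜ v)

instance : IsSuperModule g (FreeMod g V) :=
  isSuperModule_of_parity (by
    intro x m
    induction m using TensorProduct.induction_on with
    | zero => simp
    | tmul a b => simp [TensorProduct.smul_tmul', parity_tmul]
    | add a b ha hb => simp [ha, hb])

end Free

section Quotient

variable {g : Type u} [AddCommGroup g] [Module ℂ g] [LieSuperalgebra g]
variable {M : Type v} [AddCommGroup M] [Module ℂ M] [Module (Env g) M]
    [IsScalarTower ℂ (Env g) M] [SuperSpace M]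

theorem isGraded_of_parity {N : AddSubgroup M} (hc : ∀ (c : ℂ), ∀ m ∈ N, c • m ∈ N)
    (h : ∀ m ∈ N, parity M m ∈ N) : IsGraded N := by
  intro a ha b hb hab
  have h1 := h _ hab
  rw [map_add, parity_of_mem ha, parity_of_mem hb] at h1
  simp only [paritySign, if_true, one_smul, one_ne_zero, if_false, neg_smul] at h1
  have h2 : a ∈ N := by
    have h3 := hc 2⁻¹ _ (N.add_mem hab h1)
    have h4 : a + b + (a + -b) = (2 : ℂ) • a := by rw [two_smul]; abel
    rw [h4, smul_smul] at h3
    simpa using h3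
  exact ⟨h2, by simpa using N.sub_mem hab h2⟩

theorem IsGraded.parity_mem {N : AddSubgroup M} (h : IsGraded N) {m : M} (hm : m ∈ N) :
    parity M m ∈ N := by
  obtain ⟨a, ha, b, hb, rfl⟩ := exists_homogeneous m
  obtain ⟨h1, h2⟩ := h a ha b hb hm
  rw [map_add, parity_of_mem ha, parity_of_mem hb]
  simpa [paritySign, sub_eq_add_neg] using N.sub_mem h1 h2

theorem isGraded_span [IsSuperModule g M] {R : Set M}
    (hR : ∀ m ∈ R, parity M m ∈ Submodule.span (Env g) R) :
    IsGraded (Submodule.span (Env g) R).toAddSubgroup := by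
  refine isGraded_of_parity ?_ ?_
  · intro c m hm
    have h := (Submodule.span (Env g) R).smul_mem (algebraMap ℂ (Env g) c) hm
    rwa [algebraMap_smul] at h
  · intro m hm
    induction hm using Submodule.span_induction with
    | mem x hx => exact hR x hx
    | zero => rw [map_zero]; exact zero_mem _
    | add x y _ _ hx hy => rw [map_add]; exact add_mem hx hy
    | smul a x _ hx =>
      rw [parity_smul]
      exact (Submodule.span (Env g) R).smul_mem _ hx

/-- The grading of the quotient of a supermodule by a graded submodule. -/
@[reducible]
def quotientSuperSpace (N : Submodule (Env g) M) (hN : IsGraded N.toAddSubgroup) :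
    SuperSpace (M ⧸ N) where
  gr i := (gr i : Submodule ℂ M).map (N.mkQ.restrictScalars ℂ)
  isCompl_gr := by
    constructor
    · rw [Submodule.disjoint_def]
      rintro _ ⟨a, ha, rfl⟩ ⟨b, hb, hab⟩
      have h1 : a + -b ∈ N := by
        rw [← sub_eq_add_neg]
        exact (Submodule.Quotient.eq N).1 hab.symm
      exact (Submodule.Quotient.mk_eq_zero N).2 (hN a ha (-b) (neg_mem hb) h1).1
    · rw [codisjoint_iff, eq_top_iff]
      intro x _
      obtain ⟨m, rfl⟩ := N.mkQ_surjective x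
      obtain ⟨a, ha, b, hb, rfl⟩ := exists_homogeneous m
      rw [map_add]
      exact Submodule.add_mem_sup ⟨a, ha, rfl⟩ ⟨b, hb, rfl⟩

theorem quotient_isSuperModule [IsSuperModule g M] (N : Submodule (Env g) M)
    (hN : IsGraded N.toAddSubgroup) :
    let _ := quotientSuperSpace N hN
    IsSuperModule g (M ⧸ N) :=
  let _ := quotientSuperSpace N hN
  { smul_mem := by
      rintro i j x _ hx ⟨m, hm, rfl⟩
      exact ⟨Env.ι x • m, IsSuperModule.smul_mem hx hm, rfl⟩ }

end Quotient

/-! ### Triangular decomposition, weights and roots of `q(n)` -/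

namespace Queer

/-- The standard Cartan subalgebra `h = h₀ ⊕ h₁`: both blocks are diagonal. -/
def cartan (n : ℕ) : Submodule ℂ (Queer n) where
  carrier := {M | (evenBlock M).IsDiag ∧ (oddBlock M).IsDiag}
  zero_mem' := by simp
  add_mem' := fun ha hb => by
    simpa using ⟨ha.1.add hb.1, ha.2.add hb.2⟩
  smul_mem' := fun c _ ha => by
    simpa using ⟨ha.1.smul c, ha.2.smul c⟩

/-- The even part `h₀` of the Cartan subalgebra. -/
def cartanEven (n : ℕ) : Submodule ℂ (Queer n) := cartan n ⊓ gr 0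

/-- The subalgebra `n⁺`: both blocks are strictly upper triangular. -/
def nPlus (n : ℕ) : Submodule ℂ (Queer n) where
  carrier := {M | ∀ i j, j ≤ i → evenBlock M i j = 0 ∧ oddBlock M i j = 0}
  zero_mem' := by simp
  add_mem' := fun ha hb i j hij => by
    simp [(ha i j hij).1, (ha i j hij).2, (hb i j hij).1, (hb i j hij).2]
  smul_mem' := fun c _ ha i j hij => by
    simp [(ha i j hij).1, (ha i j hij).2]

variable {n : ℕ}

/-- The even basis element `(E_{ij} | 0 ; 0 | E_{ij})`. -/
def evenE (i j : Fin n) : Queer n := mk (Matrix.single i j 1) 0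

/-- The odd basis element `(0 | E_{ij} ; E_{ij} | 0)`. -/
def oddE (i j : Fin n) : Queer n := mk 0 (Matrix.single i j 1)

/-- The basis element `k_i` of `h₀`. -/
def kEven (i : Fin n) : cartanEven n :=
  ⟨evenE i i, ⟨by
    intro a b hab
    simp only [evenE, evenBlock_mk, Matrix.single_apply]
    rw [if_neg]
    rintro ⟨rfl, rfl⟩
    exact hab rfl, by simp [evenE]⟩, by simp [evenE, gr]⟩

/-- The functional `ε_i` on `h₀`, the `i`-th diagonal entry. -/
def epsilon (i : Fin n) : Module.Dual ℂ (cartanEven n) where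
  toFun h := evenBlock (h : Queer n) i i
  map_add' _ _ := by simp
  map_smul' _ _ := by simp

theorem parity_mk (X Y : Matrix (Fin n) (Fin n) ℂ) : parity (Queer n) (mk X Y) = mk X (-Y) := by
  have h : mk X Y = mk X 0 + mk 0 Y := ext_blocks (by simp) (by simp)
  have h0 : mk X 0 ∈ (gr 0 : Submodule ℂ (Queer n)) := by simp [gr]
  have h1 : mk 0 Y ∈ (gr 1 : Submodule ℂ (Queer n)) := by simp [gr]
  rw [h, map_add, parity_of_mem h0, parity_of_mem h1]
  exact ext_blocks (by simp [paritySign]) (by simp [paritySign])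

theorem parity_eq (M : Queer n) : parity (Queer n) M = mk (evenBlock M) (-oddBlock M) := by
  rw [← parity_mk, mk_eta]

theorem parity_mem_cartan {M : Queer n} (hM : M ∈ cartan n) : parity (Queer n) M ∈ cartan n := by
  rw [parity_eq]
  exact ⟨hM.1, by simpa using hM.2.neg⟩

theorem parity_mem_nPlus {M : Queer n} (hM : M ∈ nPlus n) : parity (Queer n) M ∈ nPlus n := by
  rw [parity_eq]
  intro i j hij
  simpa using hM i j hij

theorem parity_cartanEven (h : cartanEven n) : parity (Queer n) (h : Queer n) = h := by
  rw [parity_of_mem (i := 0) h.2.2]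
  simp [paritySign]

theorem parity_evenE (i j : Fin n) : parity (Queer n) (evenE i j) = evenE i j := by
  rw [evenE, parity_mk, neg_zero]

/-- The monoid `Q⁺` of nonnegative integer combinations of the simple roots
`α_i = ε_i - ε_{i+1}`. -/
def rootMonoid (n : ℕ) : AddSubmonoid (Module.Dual ℂ (cartanEven n)) :=
  AddSubmonoid.closure {α | ∃ i j : Fin n, (j : ℕ) = i + 1 ∧ α = epsilon i - epsilon j}

/-- The set `Λ⁺` of dominant integral weights of `q(n)`: with `λ_i = λ(k_i)`, each
`λ_i - λ_{i+1}` is a nonnegative integer, and it vanishes only if `λ_i = λ_{i+1} = 0`. -/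
def dominantWeights (n : ℕ) : Set (Module.Dual ℂ (cartanEven n)) :=
  {lam | ∀ i j : Fin n, (j : ℕ) = i + 1 →
    (∃ m : ℕ, lam (kEven i) - lam (kEven j) = m) ∧
    (lam (kEven i) = lam (kEven j) → lam (kEven i) = 0 ∧ lam (kEven j) = 0)}

end Queer

open Queer

/-! ### Weight spaces -/

section Weights

variable {n : ℕ}

/-- The Lie superalgebra `q(n) ⊗ A`. -/
abbrev Current (n : ℕ) (A : Type v) [CommRing A] [Algebra ℂ A] : Type v := Queer n ⊗[ℂ] A

variable (n) in
/-- The inclusion `q(n) → q(n) ⊗ A`, `x ↦ x ⊗ 1`. -/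
def incl (A : Type v) [CommRing A] [Algebra ℂ A] : Queer n →ₗ[ℂ] Current n A :=
  (TensorProduct.mk ℂ (Queer n) A).flip 1

theorem incl_apply (A : Type v) [CommRing A] [Algebra ℂ A] (x : Queer n) :
    incl n A x = x ⊗ₜ 1 := rfl

theorem incl_even (A : Type v) [CommRing A] [Algebra ℂ A] : IsEvenMap (incl n A) :=
  fun i x hx => ⟨(⟨x, hx⟩ : (gr i : Submodule ℂ (Queer n))) ⊗ₜ 1, rfl⟩

theorem incl_bracket (A : Type v) [CommRing A] [Algebra ℂ A] (x y : Queer n) :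
    incl n A (bracket x y) =
      (currentAlgebra (Queer n) A).bracket (incl n A x) (incl n A y) := by
  change (bracket x y : Queer n) ⊗ₜ[ℂ] (1 : A) = (bracket x y : Queer n) ⊗ₜ[ℂ] ((1 : A) * 1)
  rw [mul_one]

theorem parity_map {V : Type u} {W : Type v} [AddCommGroup V] [Module ℂ V] [SuperSpace V]
    [AddCommGroup W] [Module ℂ W] [SuperSpace W] {f : V →ₗ[ℂ] W} (hf : IsEvenMap f) (x : V) :
    parity W (f x) = f (parity V x) := by
  induction x using homogeneous_induction with
  | h i x hx => rw [parity_of_mem (hf i x hx), parity_of_mem hx, map_smul]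
  | hadd x y hx hy => simp [hx, hy]

variable (g : Type u) [AddCommGroup g] [Module ℂ g] [LieSuperalgebra g]

/-- The weight space `M_μ = {m | h m = μ(h) m for all h ∈ h₀}` of a `g`-module `M`, where `q(n)`
acts through a map `c : q(n) → g`. -/
def weightSpaceOf (c : Queer n →ₗ[ℂ] g) (M : Type v) [AddCommGroup M] [Module ℂ M]
    [Module (Env g) M] [IsScalarTower ℂ (Env g) M] (μ : Module.Dual ℂ (cartanEven n)) :
    Submodule ℂ M where
  carrier := {m | ∀ h : cartanEven n, Env.ι (c h) • m = μ h • m}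
  zero_mem' := by simp
  add_mem' := fun ha hb h => by rw [smul_add, smul_add, ha h, hb h]
  smul_mem' := fun r _ ha h => by rw [smul_comm, ha h, smul_comm]

variable {g} in
theorem parity_mem_weightSpace {c : Queer n →ₗ[ℂ] g} (hc : IsEvenMap c) {M : Type v}
    [AddCommGroup M] [Module ℂ M] [Module (Env g) M] [IsScalarTower ℂ (Env g) M] [SuperSpace M]
    [IsSuperModule g M] {μ : Module.Dual ℂ (cartanEven n)} {m : M}
    (hm : m ∈ weightSpaceOf g c M μ) : parity M m ∈ weightSpaceOf g c M μ := by
  intro h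
  have e := congrArg (parity M) (hm h)
  rwa [parity_ι_smul, parity_map hc, parity_cartanEven, map_smul] at e

/-- The grading of a graded subspace. -/
@[reducible]
def subSuperSpace {V : Type v} [AddCommGroup V] [Module ℂ V] [SuperSpace V] (N : Submodule ℂ V)
    (hN : ∀ x ∈ N, parity V x ∈ N) : SuperSpace N where
  gr i := (gr i : Submodule ℂ V).comap N.subtype
  isCompl_gr := by
    constructor
    · rw [Submodule.disjoint_def]
      intro x hx hy
      exact Subtype.ext ((Submodule.disjoint_def.1 (isCompl_gr (V := V)).disjoint) _ hx hy)
    · rw [codisjoint_iff, eq_top_iff]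
      rintro ⟨x, hx⟩ _
      obtain ⟨a, ha, b, hb, rfl⟩ := exists_homogeneous x
      have h2 := hN _ hx
      rw [map_add, parity_of_mem ha, parity_of_mem hb] at h2
      simp only [paritySign, if_true, one_smul, one_ne_zero, if_false, neg_smul] at h2
      have h3 : a ∈ N := by
        have h4 := N.smul_mem (2⁻¹ : ℂ) (N.add_mem hx h2)
        have h5 : a + b + (a + -b) = (2 : ℂ) • a := by rw [two_smul]; abel
        rw [h5, smul_smul] at h4
        simpa using h4
      have h4 : b ∈ N := by simpa using N.sub_mem hx h3
      exact Submodule.mem_sup.2 ⟨⟨a, h3⟩, ha, ⟨b, h4⟩, hb, rfl⟩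

/-- The weight space `M_μ` of a `q(n) ⊗ A`-module `M`. -/
abbrev weightSpace (A : Type u) [CommRing A] [Algebra ℂ A] (M : Type v) [AddCommGroup M]
    [Module ℂ M] [Module (Env (Current n A)) M] [IsScalarTower ℂ (Env (Current n A)) M]
    (μ : Module.Dual ℂ (cartanEven n)) : Submodule ℂ M :=
  weightSpaceOf (Current n A) (incl n A) M μ

instance weightSpaceSuperSpace (A : Type u) [CommRing A] [Algebra ℂ A] (M : Type v)
    [AddCommGroup M] [Module ℂ M] [Module (Env (Current n A)) M]
    [IsScalarTower ℂ (Env (Current n A)) M] [SuperSpace M]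
    [IsSuperModule (Current n A) M] (μ : Module.Dual ℂ (cartanEven n)) :
    SuperSpace (weightSpace A M μ) :=
  subSuperSpace _ (fun _ => parity_mem_weightSpace (incl_even A))

/-- The weight space `L_μ` of a `q(n)`-module `L`. -/
abbrev queerWeightSpace (L : Type u) [AddCommGroup L] [Module ℂ L] [Module (Env (Queer n)) L]
    [IsScalarTower ℂ (Env (Queer n)) L] (μ : Module.Dual ℂ (cartanEven n)) : Submodule ℂ L :=
  weightSpaceOf (Queer n) LinearMap.id L μ

instance queerWeightSpaceSuperSpace (L : Type u) [AddCommGroup L] [Module ℂ L]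
    [Module (Env (Queer n)) L] [IsScalarTower ℂ (Env (Queer n)) L] [SuperSpace L]
    [IsSuperModule (Queer n) L] (μ : Module.Dual ℂ (cartanEven n)) :
    SuperSpace (queerWeightSpace L μ) :=
  subSuperSpace _ (fun _ => parity_mem_weightSpace (fun _ _ h => h))

end Weights

/-! ### Irreducible highest weight modules -/

section HighestWeight

variable {n : ℕ} (L : Type u) [AddCommGroup L] [Module ℂ L] [Module (Env (Queer n)) L]
  [IsScalarTower ℂ (Env (Queer n)) L] [SuperSpace L] [IsSuperModule (Queer n) L]
  (lam : Module.Dual ℂ (cartanEven n))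

/-- `L` is a highest weight `q(n)`-module of highest weight `λ`. Weight spaces of different weights
are always independent, so that `iSup_eq_top` says that `L` is a weight module. -/
structure IsHighestWeight : Prop where
  iSup_eq_top : ⨆ μ : Module.Dual ℂ (cartanEven n), queerWeightSpace L μ = ⊤
  ne_bot : queerWeightSpace L lam ≠ ⊥
  finite : FiniteDimensional ℂ (queerWeightSpace L lam)
  span_eq_top : Submodule.span (Env (Queer n)) (queerWeightSpace L lam : Set L) = ⊤
  raise : ∀ i j : Fin n, (j : ℕ) = i + 1 → ∀ v ∈ queerWeightSpace L lam,
    (Env.ι (evenE i j) : Env (Queer n)) • v = 0 ∧ (Env.ι (oddE i j) : Env (Queer n)) • v = 0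

/-- `L` is an irreducible highest weight `q(n)`-supermodule of highest weight `λ`, in other words
one of the (two, up to even isomorphism) modules `L(λ)`. -/
structure IsIrreducibleHighestWeight : Prop extends IsHighestWeight L lam where
  eq_bot_or_top : ∀ N : Submodule (Env (Queer n)) L, IsGraded N.toAddSubgroup → N = ⊥ ∨ N = ⊤

/-! ### The module `L̄(λ)` -/

/-- The defining relations of `L̄(λ)`: the generating space `L(λ)_λ` keeps its structure of a module
over `h`, and `n⁺ k = 0`, `h k = λ(h) k` for `h ∈ h₀`, `f_i^{λ(h_i)+1} k = 0`. -/
inductive LbarRel : FreeMod (Queer n) (queerWeightSpace L lam) → Prop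
  | cartan (x : Queer n) (hx : x ∈ cartan n) (k k' : queerWeightSpace L lam)
      (hk : (Env.ι x : Env (Queer n)) • (k : L) = k') :
      LbarRel (Env.ι x ⊗ₜ k - 1 ⊗ₜ k')
  | nPlus (x : Queer n) (hx : x ∈ nPlus n) (k : queerWeightSpace L lam) :
      LbarRel (Env.ι x ⊗ₜ k)
  | weight (h : cartanEven n) (k : queerWeightSpace L lam) :
      LbarRel (Env.ι (h : Queer n) ⊗ₜ k - lam h • (1 ⊗ₜ k))
  | lower (i j : Fin n) (hij : (j : ℕ) = i + 1) (m : ℕ)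
      (hm : lam (kEven i) - lam (kEven j) = m) (k : queerWeightSpace L lam) :
      LbarRel (((Env.ι (evenE j i) : Env (Queer n)) ^ (m + 1)) ⊗ₜ k)

/-- The submodule of relations of `L̄(λ)`. -/
def lbarSub : Submodule (Env (Queer n)) (FreeMod (Queer n) (queerWeightSpace L lam)) :=
  Submodule.span (Env (Queer n)) {t | LbarRel L lam t}

theorem lbarSub_graded : IsGraded (lbarSub L lam).toAddSubgroup := by
  apply isGraded_span
  intro t ht
  apply Submodule.subset_span
  have hcoe : ∀ k : queerWeightSpace L lam,
      ((parity (queerWeightSpace L lam) k : queerWeightSpace L lam) : L) = parity L k := by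
    intro k
    exact (parity_map (f := (queerWeightSpace L lam).subtype) (fun i x hx => hx) k).symm
  obtain ⟨x, hx, k, k', hk⟩ | ⟨x, hx, k⟩ | ⟨h, k⟩ | ⟨i, j, hij, m, hm, k⟩ := ht
  · rw [map_sub, parity_tmul, parity_tmul, Env.parityHom_ι, map_one]
    refine LbarRel.cartan _ (parity_mem_cartan hx) _ _ ?_
    rw [hcoe, hcoe, ← hk, parity_ι_smul]
  · rw [parity_tmul, Env.parityHom_ι]
    exact LbarRel.nPlus _ (parity_mem_nPlus hx) _
  · rw [map_sub, map_smul, parity_tmul, parity_tmul, Env.parityHom_ι, parity_cartanEven, map_one]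
    exact LbarRel.weight h _
  · rw [parity_tmul, map_pow, Env.parityHom_ι, parity_evenE]
    exact LbarRel.lower i j hij m hm _

/-- The `q(n)`-supermodule `L̄(λ)`. -/
abbrev Lbar : Type u := FreeMod (Queer n) (queerWeightSpace L lam) ⧸ lbarSub L lam

instance : SuperSpace (Lbar L lam) := quotientSuperSpace _ (lbarSub_graded L lam)

instance : IsSuperModule (Queer n) (Lbar L lam) := quotient_isSuperModule _ (lbarSub_graded L lam)

/-- The vector `k_λ ∈ L̄(λ)` given by `k ∈ L(λ)_λ`. -/
def lbarGen : queerWeightSpace L lam →ₗ[ℂ] Lbar L lam :=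
  (lbarSub L lam).mkQ.restrictScalars ℂ ∘ₗ TensorProduct.mk ℂ (Env (Queer n)) _ 1

end HighestWeight

/-! ### The induced module `P_A(V)` -/

section Induced

variable {n : ℕ} (A : Type v) [CommRing A] [Algebra ℂ A]

variable (n) in
/-- The homomorphism `U(q(n)) → U(q(n) ⊗ A)`. -/
def envIncl : Env (Queer n) →ₐ[ℂ] Env (Current n A) :=
  Env.map (incl n A) (incl_even A) (incl_bracket A)

theorem envIncl_ι (x : Queer n) : envIncl n A (Env.ι x) = Env.ι (incl n A x) := by
  rw [envIncl, Env.map_ι]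

theorem parityHom_envIncl (s : Env (Queer n)) :
    Env.parityHom (envIncl n A s) = envIncl n A (Env.parityHom s) := by
  have h : (Env.parityHom).comp (envIncl n A) = (envIncl n A).comp Env.parityHom := by
    apply Env.algHom_ext
    intro x
    simp only [AlgHom.comp_apply, Env.parityHom_ι, envIncl_ι]
    rw [parity_map (incl_even A)]
  exact DFunLike.congr_fun h s

variable (V : Type u) [AddCommGroup V] [Module ℂ V] [Module (Env (Queer n)) V]
  [IsScalarTower ℂ (Env (Queer n)) V] [SuperSpace V] [IsSuperModule (Queer n) V]

variable (n) in
/-- The relations `u s ⊗ v = u ⊗ s v`, `s ∈ U(q(n))`, that turn `U(q(n) ⊗ A) ⊗_ℂ V` into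
`U(q(n) ⊗ A) ⊗_{U(q(n))} V`. -/
def inducedSub : Submodule (Env (Current n A)) (FreeMod (Current n A) V) :=
  Submodule.span (Env (Current n A))
    {t | ∃ (u : Env (Current n A)) (s : Env (Queer n)) (v : V),
      t = (u * envIncl n A s) ⊗ₜ v - u ⊗ₜ (s • v)}

variable (n) in
theorem inducedSub_graded : IsGraded (inducedSub n A V).toAddSubgroup := by
  apply isGraded_span
  rintro _ ⟨u, s, v, rfl⟩
  apply Submodule.subset_span
  refine ⟨Env.parityHom u, Env.parityHom s, parity V v, ?_⟩
  rw [map_sub, parity_tmul, parity_tmul, map_mul, parityHom_envIncl, parity_smul]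

variable (n) in
/-- The `q(n) ⊗ A`-supermodule `P_A(V) = U(q(n) ⊗ A) ⊗_{U(q(n))} V`. -/
abbrev Induced : Type (max u v) := FreeMod (Current n A) V ⧸ inducedSub n A V

instance : SuperSpace (Induced n A V) := quotientSuperSpace _ (inducedSub_graded n A V)

instance : IsSuperModule (Current n A) (Induced n A V) :=
  quotient_isSuperModule _ (inducedSub_graded n A V)

variable (n) in
/-- The map `V → P_A(V)`, `v ↦ 1 ⊗ v`. -/
def inducedGen : V →ₗ[ℂ] Induced n A V :=
  (inducedSub n A V).mkQ.restrictScalars ℂ ∘ₗ TensorProduct.mk ℂ (Env (Current n A)) V 1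

end Induced

/-! ### The truncation `M^ν` -/

section Truncation

variable {n : ℕ} (A : Type v) [CommRing A] [Algebra ℂ A] (M : Type u) [AddCommGroup M]
  [Module ℂ M] [Module (Env (Current n A)) M] [IsScalarTower ℂ (Env (Current n A)) M]
  [SuperSpace M] [IsSuperModule (Current n A) M] (ν : Module.Dual ℂ (cartanEven n))

/-- The submodule `∑_{μ ∉ ν - Q⁺} U(q(n) ⊗ A) M_μ`. -/
def truncSub : Submodule (Env (Current n A)) M :=
  Submodule.span (Env (Current n A))
    {m | ∃ μ : Module.Dual ℂ (cartanEven n), ν - μ ∉ rootMonoid n ∧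
      m ∈ weightSpace A M μ}

theorem truncSub_graded : IsGraded (truncSub A M ν).toAddSubgroup := by
  apply isGraded_span
  rintro m ⟨μ, hμ, hm⟩
  exact Submodule.subset_span ⟨μ, hμ, parity_mem_weightSpace (incl_even A) hm⟩

/-- The quotient `M^ν` of `M`. -/
abbrev Truncation : Type u := M ⧸ truncSub A M ν

instance : SuperSpace (Truncation A M ν) := quotientSuperSpace _ (truncSub_graded A M ν)

instance : IsSuperModule (Current n A) (Truncation A M ν) :=
  quotient_isSuperModule _ (truncSub_graded A M ν)

end Truncation

/-! ### Global Weyl modules -/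

section Weyl

variable {n : ℕ} (A : Type v) [CommRing A] [Algebra ℂ A]

/-- The global Weyl module `W_A(λ) = P_A(L̄(λ))^λ`, for a given choice of `L(λ)`. -/
abbrev GlobalWeyl (L : Type u) [AddCommGroup L] [Module ℂ L] [Module (Env (Queer n)) L]
    [IsScalarTower ℂ (Env (Queer n)) L] [SuperSpace L] [IsSuperModule (Queer n) L]
    (lam : Module.Dual ℂ (cartanEven n)) : Type (max u v) :=
  Truncation A (Induced n A (Lbar L lam)) lam

/-- The map `k_λ ↦ w_λ` from `L(λ)_λ` to `W_A(λ)`. -/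
def weylGen (L : Type u) [AddCommGroup L] [Module ℂ L] [Module (Env (Queer n)) L]
    [IsScalarTower ℂ (Env (Queer n)) L] [SuperSpace L] [IsSuperModule (Queer n) L]
    (lam : Module.Dual ℂ (cartanEven n)) :
    queerWeightSpace L lam →ₗ[ℂ] GlobalWeyl A L lam :=
  (truncSub A (Induced n A (Lbar L lam)) lam).mkQ.restrictScalars ℂ ∘ₗ
    inducedGen n A (Lbar L lam) ∘ₗ lbarGen L lam

/-- The relations `(n⁺ ⊗ A) w = 0`, `h w = λ(h) w` for `h ∈ h₀`, and `f_i^{λ(h_i)+1} w = 0` for an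
element `w` of a `q(n) ⊗ A`-module. -/
structure WeylRel (lam : Module.Dual ℂ (cartanEven n)) {M : Type u} [AddCommGroup M] [Module ℂ M]
    [Module (Env (Current n A)) M] (w : M) : Prop where
  nPlus : ∀ x ∈ nPlus n, ∀ a : A, (Env.ι (x ⊗ₜ a) : Env (Current n A)) • w = 0
  weight : ∀ h : cartanEven n,
    (Env.ι ((h : Queer n) ⊗ₜ 1) : Env (Current n A)) • w = lam h • w
  lower : ∀ i j : Fin n, (j : ℕ) = i + 1 → ∀ m : ℕ, lam (kEven i) - lam (kEven j) = m →
    (Env.ι (evenE j i ⊗ₜ 1) : Env (Current n A)) ^ (m + 1) • w = 0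

/-- The `q(n) ⊗ A`-supermodule `W` is generated by the image of the even map `j : V → W`, with the
defining relations `y j(v) = j(v')` for `act y v v'`, together with `WeylRel` for all `j(v)`: these
relations hold in `W`, and `W` is universal among the supermodules in which they hold. -/
structure IsWeylPresentation (lam : Module.Dual ℂ (cartanEven n))
    {V : Type u} [AddCommGroup V] [Module ℂ V] [SuperSpace V]
    (act : Current n A → V → V → Prop)
    {W : Type (max u v)} [AddCommGroup W] [Module ℂ W] [Module (Env (Current n A)) W]
    [SuperSpace W] (j : V →ₗ[ℂ] W) : Prop where
  even : IsEvenMap j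
  span_eq_top : Submodule.span (Env (Current n A)) (Set.range j) = ⊤
  smul_eq : ∀ y v v', act y v v' → (Env.ι y : Env (Current n A)) • j v = j v'
  rel : ∀ v, WeylRel A lam (j v)
  existsUnique : ∀ (M : Type w) [AddCommGroup M] [Module ℂ M] [Module (Env (Current n A)) M]
    [IsScalarTower ℂ (Env (Current n A)) M] [SuperSpace M]
    [IsSuperModule (Current n A) M] (φ : V →ₗ[ℂ] M), IsEvenMap φ →
    (∀ y v v', act y v v' → (Env.ι y : Env (Current n A)) • φ v = φ v') →
    (∀ v, WeylRel A lam (φ v)) →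
    ∃! Φ : W →ₗ[Env (Current n A)] M, IsEvenMap Φ ∧ ∀ v, Φ (j v) = φ v

variable (n) in
/-- The subalgebra `h ⊗ A` of `q(n) ⊗ A`. -/
def cartanCurrent : Submodule ℂ (Current n A) :=
  LinearMap.range ((cartan n).subtype.rTensor A)

end Weyl

end QueerWeyl

end

open QueerWeyl QueerWeyl.Queer

/-!
If a module `M` is generated by a set `X` of vectors of weight `λ` that are killed by `n⁺ ⊗ A`, then
the commutation relations alone, without the Poincaré–Birkhoff–Witt theorem, give
`M = U((h ⊕ n⁻) ⊗ A) X`, so all weights of `M` lie in `λ - Q⁺` and `M_λ` is spanned by the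
`U(h ⊗ A)`-translates of `X`. Three things follow.

* `n⁺ ⊗ A` raises `M_λ` into weights outside `λ - Q⁺`, hence kills it. If each `f_i` is nilpotent
  on the elements of `X`, it is locally nilpotent on `M`, because `ad f_i` is nilpotent, and
  `sl₂`-theory gives `f_i^{λ(h_i)+1} M_λ = 0`. So the relations pass from `X` to `M_λ`.
* An `h ⊗ A`-linear map on `M_λ` is determined by its values on `X`, so that the universal property
  of `X` implies that of `M_λ`.
* If a homomorphism from `P` sends generators of `P` to vectors as in `X`, then all weights of its
  image lie in `λ - Q⁺`, so that it kills `∑_{μ ∉ λ - Q⁺} U(q(n) ⊗ A) P_μ` and factors through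
  `W_A(λ)`.
-/

namespace QueerWeyl

open SuperSpace LieSuperalgebra Queer

/-! ### Modules over enveloping superalgebras -/

section Enveloping

attribute [local instance] LieRing.ofAssociativeRing

section Associative

variable {R : Type u} {B : Type v} {M : Type w} [Ring B] [AddCommGroup M] [Module B M]

theorem smul_mem_maxGenEigenspace_zero [CommRing R] [Algebra R B] [Module R M]
    [IsScalarTower R B M] {a b : B} {m : M}
    (hb : b ∈ (LieAlgebra.ad R B a).maxGenEigenspace 0)
    (hm : m ∈ (Algebra.lsmul R R M a).maxGenEigenspace 0) :
    b • m ∈ (Algebra.lsmul R R M a).maxGenEigenspace 0 := by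
  let _ := LieRingModule.ofAssociativeModule (A := B) (M := M)
  have := LieModule.ofAssociativeModule (R := R) (A := B) (M := M)
  have h := LieModule.lie_mem_maxGenEigenspace_toEnd (R := R) (M := M) (χ₁ := 0) (χ₂ := 0) hb hm
  rwa [add_zero] at h

theorem pow_succ_smul_eq_zero_of_primitive [Field R] [CharZero R] [Algebra R B] [Module R M]
    [IsScalarTower R B M] {h e f : B} (hef : ⁅e, f⁆ = h) (hhe : ⁅h, e⁆ = 2 • e)
    (hhf : ⁅h, f⁆ = -(2 • f)) {w : M} {m : ℕ} (hw : h • w = (m : R) • w) (he : e • w = 0)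
    (hf : w ∈ (Algebra.lsmul R R M f).maxGenEigenspace 0) : f ^ (m + 1) • w = 0 := by
  obtain rfl | w0 := eq_or_ne w 0
  · exact smul_zero _
  obtain rfl | h0 := eq_or_ne h 0
  · have hf0 : f = 0 := by
      have : (2 : R) • f = 0 := by
        rw [ofNat_smul_eq_nsmul, ← neg_eq_zero, ← hhf, zero_lie]
      simpa using this
    rw [hf0, zero_pow m.succ_ne_zero, zero_smul]
  let _ := LieRingModule.ofAssociativeModule (A := B) (M := M)
  have := LieModule.ofAssociativeModule (R := R) (A := B) (M := M)
  have t : IsSl2Triple h e f := ⟨h0, hef, hhe, hhf⟩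
  have P : t.HasPrimitiveVectorWith w (m : R) := ⟨w0, hw, he⟩
  have htoEnd (k : ℕ) : (LieModule.toEnd R B M f ^ k) w = f ^ k • w := by
    change (Algebra.lsmul R R M f ^ k) w = _
    rw [← map_pow, Algebra.lsmul_coe]
  have hnil : ∃ k, f ^ k • w = 0 := by
    obtain ⟨k, hk⟩ := (Module.End.mem_maxGenEigenspace _ _ _).1 hf
    exact ⟨k, by simpa [← map_pow] using hk⟩
  obtain ⟨k, hk0, hk⟩ := Nat.exists_not_and_succ_of_not_zero_of_exists
    (p := fun k => f ^ k • w = 0) (by simpa using w0) hnil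
  have hk' := P.lie_e_pow_succ_toEnd_f k
  rw [htoEnd, htoEnd, hk, lie_zero, eq_comm, smul_eq_zero_iff_left hk0] at hk'
  have hmk : (m : R) = k :=
    sub_eq_zero.1 ((mul_eq_zero.1 hk').resolve_left k.cast_add_one_ne_zero)
  rwa [Nat.cast_injective hmk]

end Associative

variable {g : Type u} [AddCommGroup g] [Module ℂ g] [LieSuperalgebra g]

theorem Env.adjoin_range_ι : Algebra.adjoin ℂ (Set.range (Env.ι : g → Env g)) = ⊤ := by
  let S := Algebra.adjoin ℂ (Set.range (Env.ι : g → Env g))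
  let j : g →ₗ[ℂ] S := LinearMap.codRestrict (Subalgebra.toSubmodule S) Env.ι
    fun x => Algebra.subset_adjoin ⟨x, rfl⟩
  let f : Env g →ₐ[ℂ] S := Env.lift j fun hx hy => Subtype.ext (Env.ι_mul_ι hx hy)
  have hf : S.val.comp f = AlgHom.id ℂ (Env g) :=
    Env.algHom_ext fun x => congrArg S.val (Env.lift_ι j _ x)
  refine eq_top_iff.2 fun a _ => ?_
  rw [← AlgHom.id_apply (R := ℂ) a, ← hf]
  exact (f a).2

theorem Env.lie_ι_of_even {y : g} (hy : y ∈ (gr 0 : Submodule ℂ g)) (x : g) :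
    ⁅(Env.ι y : Env g), Env.ι x⁆ = Env.ι (bracket y x) := by
  induction x using homogeneous_induction with
  | h i x hx => rw [Ring.lie_def, Env.ι_mul_ι hy hx]; simp [superSign]
  | hadd a b ha hb => rw [map_add, lie_add, ha, hb, map_add, map_add]

variable {M : Type v} [AddCommGroup M] [Module (Env g) M]

theorem ι_smul_ι_smul_of_even {y : g} (hy : y ∈ (gr 0 : Submodule ℂ g)) (x : g) (m : M) :
    (Env.ι y : Env g) • (Env.ι x : Env g) • m =
      (Env.ι (bracket y x) : Env g) • m + (Env.ι x : Env g) • (Env.ι y : Env g) • m := by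
  rw [← Env.lie_ι_of_even hy, Ring.lie_def, sub_smul, mul_smul, mul_smul, sub_add_cancel]

variable [Module ℂ M] [IsScalarTower ℂ (Env g) M]

theorem ι_smul_mem_maxGenEigenspace_zero {x y : g} {k : ℕ} (hy : y ∈ (gr 0 : Submodule ℂ g))
    (hx : (bracket y ^ k) x = 0) {m : M}
    (hm : m ∈ (Algebra.lsmul ℂ ℂ M (Env.ι y : Env g)).maxGenEigenspace 0) :
    (Env.ι x : Env g) • m ∈ (Algebra.lsmul ℂ ℂ M (Env.ι y : Env g)).maxGenEigenspace 0 := by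
  refine smul_mem_maxGenEigenspace_zero (R := ℂ)
    ((Module.End.mem_maxGenEigenspace _ _ _).2 ⟨k, ?_⟩) hm
  have hcomm : LieAlgebra.ad ℂ (Env g) (Env.ι y) ∘ₗ Env.ι = Env.ι ∘ₗ bracket y :=
    LinearMap.ext (Env.lie_ι_of_even hy)
  have hpow := LinearMap.congr_fun (Module.End.commute_pow_left_of_commute hcomm k) x
  rw [LinearMap.comp_apply, LinearMap.comp_apply, hx, map_zero] at hpow
  rwa [zero_smul, sub_zero]

theorem ι_smul_mem_of_mem_span {S : Set g} {m : M} {N : Submodule ℂ M}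
    (h : ∀ y ∈ S, (Env.ι y : Env g) • m ∈ N) {x : g} (hx : x ∈ Submodule.span ℂ S) :
    (Env.ι x : Env g) • m ∈ N := by
  induction hx using Submodule.span_induction with
  | mem y hy => exact h y hy
  | zero => rw [map_zero, zero_smul]; exact zero_mem _
  | add a b _ _ ha hb => rw [map_add, add_smul]; exact add_mem ha hb
  | smul c a _ ha => rw [map_smul, smul_assoc]; exact N.smul_mem c ha

theorem env_smul_mem {N : Submodule ℂ M} (hN : ∀ (x : g), ∀ m ∈ N, (Env.ι x : Env g) • m ∈ N)
    (a : Env g) {m : M} (hm : m ∈ N) : a • m ∈ N := by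
  have ha : a ∈ Algebra.adjoin ℂ (Set.range (Env.ι : g → Env g)) :=
    Env.adjoin_range_ι (g := g) ▸ Algebra.mem_top
  induction ha using Algebra.adjoin_induction generalizing m with
  | mem x hx => obtain ⟨y, rfl⟩ := hx; exact hN y m hm
  | algebraMap r => rw [algebraMap_smul]; exact N.smul_mem r hm
  | add x y _ _ hx hy => rw [add_smul]; exact N.add_mem (hx hm) (hy hm)
  | mul x y _ _ hx hy => rw [mul_smul]; exact hx (hy hm)

theorem mem_of_mem_span_of_ι_smul_mem {X : Set M} {N : Submodule ℂ M} (hX : X ⊆ N)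
    (hN : ∀ (x : g), ∀ m ∈ N, (Env.ι x : Env g) • m ∈ N) {m : M}
    (hm : m ∈ Submodule.span (Env g) X) : m ∈ N := by
  induction hm using Submodule.span_induction with
  | mem x hx => exact hX hx
  | zero => exact zero_mem _
  | add x y _ _ hx hy => exact add_mem hx hy
  | smul a x _ hx => exact env_smul_mem hN a hx

/- A weak form of the Poincaré–Birkhoff–Witt theorem: for a triangular decomposition with
`b⁻ = span B` and `n⁺ = span P` it says that `U(g) X = U(b⁻) X` if `n⁺ X = 0`. -/
theorem mem_of_mem_span_of_triangular {B P : Set g}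
    (hB : ∀ y ∈ B, ∃ i, y ∈ (gr i : Submodule ℂ g)) (hBP : Submodule.span ℂ (B ∪ P) = ⊤)
    {X : Set M} (hP : ∀ y ∈ P, ∀ m ∈ X, (Env.ι y : Env g) • m = 0) {N : Submodule ℂ M}
    (hX : X ⊆ N) (hN : ∀ y ∈ B, ∀ m ∈ N, (Env.ι y : Env g) • m ∈ N) {m : M}
    (hm : m ∈ Submodule.span (Env g) X) : m ∈ N := by
  let stable : Set (Submodule ℂ M) :=
    {N | X ⊆ N ∧ ∀ y ∈ B, ∀ m ∈ N, (Env.ι y : Env g) • m ∈ N}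
  have hsInf : sInf stable ∈ stable := by
    refine ⟨fun x hx => ?_, fun y hy m hm => ?_⟩
    · exact Submodule.mem_sInf.2 fun N hN => hN.1 hx
    · exact Submodule.mem_sInf.2 fun N hN => hN.2 y hy m (Submodule.mem_sInf.1 hm N hN)
  let S : Submodule ℂ M := sInf stable ⊓
    ⨅ x : g, (sInf stable).comap (Algebra.lsmul ℂ ℂ M (Env.ι x : Env g) : M →ₗ[ℂ] M)
  have mem_S {m : M} : m ∈ S ↔ m ∈ sInf stable ∧ ∀ x : g, (Env.ι x : Env g) • m ∈ sInf stable := by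
    simp only [S, Submodule.mem_inf, Submodule.mem_iInf, Submodule.mem_comap, Algebra.lsmul_coe]
  have hS : S ∈ stable := by
    refine ⟨fun m hm => mem_S.2 ⟨hsInf.1 hm, fun x => ?_⟩,
      fun y hy m hm => mem_S.2 ⟨hsInf.2 y hy m (mem_S.1 hm).1, fun x => ?_⟩⟩
    · refine ι_smul_mem_of_mem_span (S := B ∪ P) ?_ (hBP ▸ Submodule.mem_top)
      rintro y (hy | hy)
      · exact hsInf.2 y hy m (hsInf.1 hm)
      · rw [hP y hy m hm]
        exact zero_mem _
    · obtain ⟨j, hj⟩ := hB y hy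
      induction x using homogeneous_induction with
      | h i x hx =>
        rw [← mul_smul, Env.ι_mul_ι hx hj, add_smul, smul_assoc, mul_smul]
        exact add_mem ((mem_S.1 hm).2 _)
          (Submodule.smul_mem _ _ (hsInf.2 y hy _ ((mem_S.1 hm).2 x)))
      | hadd a b ha hb => rw [map_add, add_smul]; exact add_mem ha hb
  exact sInf_le (show N ∈ stable from ⟨hX, hN⟩) <| mem_of_mem_span_of_ι_smul_mem hsInf.1
    (fun x m hm => (mem_S.1 (sInf_le hS hm)).2 x) hm

theorem isEvenMap_of_span {M' : Type w} [AddCommGroup M'] [Module ℂ M'] [Module (Env g) M']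
    [IsScalarTower ℂ (Env g) M'] [SuperSpace M] [SuperSpace M'] [IsSuperModule g M]
    [IsSuperModule g M'] (f : M →ₗ[Env g] M') {X : Set M} (hX : Submodule.span (Env g) X = ⊤)
    (h : ∀ x ∈ X, parity M' (f x) = f (parity M x)) : IsEvenMap f := by
  have hf (m : M) : parity M' (f m) = f (parity M m) := by
    have hm : m ∈ Submodule.span (Env g) X := hX ▸ Submodule.mem_top
    induction hm using Submodule.span_induction with
    | mem x hx => exact h x hx
    | zero => simp
    | add x y _ _ hx hy => simp [hx, hy]
    | smul a x _ hx => rw [map_smul, parity_smul, parity_smul, map_smul, hx]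
  intro i m hm
  rw [mem_gr_iff] at hm ⊢
  rw [hf, hm, ← algebraMap_smul (Env g) (paritySign i) m, map_smul, algebraMap_smul]

variable (g) in
/-- The `U(g)`-linear map `U(g) ⊗ V → M` that extends a linear map `φ : V → M`. -/
def freeLift {V : Type w} [AddCommGroup V] [Module ℂ V] (φ : V →ₗ[ℂ] M) :
    FreeMod g V →ₗ[Env g] M :=
  TensorProduct.AlgebraTensorModule.lift
    (LinearMap.toSpanSingleton (Env g) (V →ₗ[ℂ] M) φ)

@[simp]
theorem freeLift_tmul {V : Type w} [AddCommGroup V] [Module ℂ V] (φ : V →ₗ[ℂ] M) (a : Env g)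
    (v : V) : freeLift g φ (a ⊗ₜ v) = a • φ v :=
  rfl

end Enveloping

/-! ### Roots of `q(n)` -/

namespace Queer

variable {n : ℕ}

/-- The difference `ε_i - ε_j`, which is a root of `q(n)` for `i ≠ j` and zero for `i = j`. -/
abbrev root (i j : Fin n) : Module.Dual ℂ (cartanEven n) := epsilon i - epsilon j

/-- The set `λ - Q⁺` of the weights below `λ` in the dominance order. -/
def weightsBelow (lam : Module.Dual ℂ (cartanEven n)) : Set (Module.Dual ℂ (cartanEven n)) :=
  {μ | lam - μ ∈ rootMonoid n}

/-- An element of `h₀` at which every simple root `ε_i - ε_{i+1}` takes the value `1`. -/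
def heightElt (n : ℕ) : cartanEven n := ∑ i : Fin n, (-(i : ℂ)) • kEven i

theorem epsilon_kEven (i j : Fin n) : epsilon i (kEven j) = if j = i then 1 else 0 := by
  simp [epsilon, kEven, evenE, Matrix.single_apply]

theorem root_heightElt (i j : Fin n) : root i j (heightElt n) = (j : ℂ) - i := by
  have h (l : Fin n) : epsilon l (heightElt n) = -(l : ℂ) := by simp [heightElt, epsilon_kEven]
  rw [LinearMap.sub_apply, h, h, neg_sub_neg]

theorem exists_nat_of_mem_rootMonoid {β : Module.Dual ℂ (cartanEven n)} (hβ : β ∈ rootMonoid n) :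
    ∃ N : ℕ, β (heightElt n) = N := by
  induction hβ using AddSubmonoid.closure_induction with
  | mem _ h =>
    obtain ⟨i, j, hij, rfl⟩ := h
    exact ⟨1, (root_heightElt i j).trans (by simp [hij])⟩
  | zero => exact ⟨0, by simp⟩
  | add _ _ _ _ hx hy =>
    obtain ⟨⟨a, ha⟩, b, hb⟩ := And.intro hx hy
    exact ⟨a + b, by rw [LinearMap.add_apply, ha, hb, Nat.cast_add]⟩

theorem root_mem_rootMonoid {i j : Fin n} (hij : i ≤ j) : root i j ∈ rootMonoid n := by
  obtain ⟨d, hd⟩ := Nat.exists_eq_add_of_le (Fin.le_def.1 hij)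
  induction d generalizing j with
  | zero =>
    obtain rfl : j = i := Fin.ext hd
    rw [root, sub_self]
    exact zero_mem _
  | succ d ih =>
    let k : Fin n := ⟨i + d, by omega⟩
    rw [root, ← sub_add_sub_cancel _ (epsilon k)]
    exact add_mem (ih (j := k) (Fin.le_def.2 (Nat.le_add_right _ _)) rfl)
      (AddSubmonoid.subset_closure ⟨k, j, hd, rfl⟩)

theorem root_notMem_rootMonoid {i j : Fin n} (hij : j < i) : root i j ∉ rootMonoid n := by
  intro h
  obtain ⟨N, hN⟩ := exists_nat_of_mem_rootMonoid h
  rw [root_heightElt, sub_eq_iff_eq_add] at hN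
  have : (j : ℕ) = N + i := by exact_mod_cast hN
  omega

theorem self_mem_weightsBelow (lam : Module.Dual ℂ (cartanEven n)) : lam ∈ weightsBelow lam := by
  simp [weightsBelow, zero_mem]

variable {lam μ : Module.Dual ℂ (cartanEven n)} {i j : Fin n}

theorem add_root_mem_weightsBelow (hμ : μ ∈ weightsBelow lam) (hij : j ≤ i) :
    μ + root i j ∈ weightsBelow lam := by
  change lam - (μ + root i j) ∈ rootMonoid n
  rw [← sub_sub, sub_eq_add_neg, neg_sub]
  exact add_mem hμ (root_mem_rootMonoid hij)

theorem add_root_ne_of_mem_weightsBelow (hμ : μ ∈ weightsBelow lam) (hij : j < i) :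
    μ + root i j ≠ lam := by
  rintro rfl
  refine root_notMem_rootMonoid hij ?_
  rwa [weightsBelow, Set.mem_ofPred_eq, add_sub_cancel_left] at hμ

theorem add_root_notMem_weightsBelow (lam : Module.Dual ℂ (cartanEven n)) (hij : i < j) :
    lam + root i j ∉ weightsBelow lam := by
  rw [weightsBelow, Set.mem_ofPred_eq, sub_add_cancel_left, neg_sub]
  exact root_notMem_rootMonoid hij

/-- The matrix unit of `q(n)` of parity `s` at the position `(i, j)`. -/
def unitE (s : ZMod 2) (i j : Fin n) : Queer n := if s = 0 then evenE i j else oddE i j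

@[simp]
theorem unitE_zero (i j : Fin n) : unitE 0 i j = evenE i j := rfl

@[simp]
theorem unitE_one (i j : Fin n) : unitE 1 i j = oddE i j := rfl

theorem unitE_mem_gr (s : ZMod 2) (i j : Fin n) : unitE s i j ∈ (gr s : Submodule ℂ (Queer n)) := by
  rcases zmod_cases s with rfl | rfl <;> simp [gr, evenE, oddE]

theorem evenE_mem_gr (i j : Fin n) : evenE i j ∈ (gr 0 : Submodule ℂ (Queer n)) :=
  unitE_mem_gr 0 i j

theorem blocks_unitE_eq_zero (s : ZMod 2) {i j a b : Fin n} (h : ¬(i = a ∧ j = b)) :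
    evenBlock (unitE s i j) a b = 0 ∧ oddBlock (unitE s i j) a b = 0 := by
  rcases zmod_cases s with rfl | rfl <;>
    simp [evenE, oddE, Matrix.single_apply_of_ne _ _ _ _ _ h]

theorem unitE_mem_nPlus (s : ZMod 2) {i j : Fin n} (hij : i < j) : unitE s i j ∈ nPlus n := by
  intro a b hba
  refine blocks_unitE_eq_zero s ?_
  rintro ⟨rfl, rfl⟩
  exact hij.not_ge hba

theorem unitE_self_mem_cartan (s : ZMod 2) (i : Fin n) : unitE s i i ∈ cartan n := by
  have h {a b : Fin n} (hab : a ≠ b) := blocks_unitE_eq_zero s (i := i) (j := i) (a := a) (b := b)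
    fun h => hab (h.1.symm.trans h.2)
  exact ⟨fun a b hab => (h hab).1, fun a b hab => (h hab).2⟩

theorem mem_span_unitE {p : Fin n → Fin n → Prop} {x : Queer n}
    (hx : ∀ i j, ¬p i j → evenBlock x i j = 0 ∧ oddBlock x i j = 0) :
    x ∈ Submodule.span ℂ {y | ∃ s i j, p i j ∧ y = unitE s i j} := by
  have hsum : x = ∑ i, ∑ j, (evenBlock x i j • unitE 0 i j + oddBlock x i j • unitE 1 i j) := by
    refine ext_blocks ?_ ?_ <;>
      simpa [evenE, oddE, Matrix.smul_single] using Matrix.matrix_eq_sum_single _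
  rw [hsum]
  refine sum_mem fun i _ => sum_mem fun j _ => ?_
  by_cases hij : p i j
  · exact add_mem (Submodule.smul_mem _ _ (Submodule.subset_span ⟨_, i, j, hij, rfl⟩))
      (Submodule.smul_mem _ _ (Submodule.subset_span ⟨_, i, j, hij, rfl⟩))
  · rw [(hx i j hij).1, (hx i j hij).2, zero_smul, zero_smul, add_zero]
    exact zero_mem _

/-- `y` is a vector of weight `α` for the adjoint action of `h₀` on `q(n)`. -/
def IsRootVector (α : Module.Dual ℂ (cartanEven n)) (y : Queer n) : Prop :=
  ∀ h : cartanEven n, bracket (h : Queer n) y = α h • y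

theorem isRootVector_of_support {α : Module.Dual ℂ (cartanEven n)} {y : Queer n}
    (h : ∀ i j, root i j ≠ α → evenBlock y i j = 0 ∧ oddBlock y i j = 0) :
    IsRootVector α y := by
  intro x
  have hodd : oddBlock (x : Queer n) = 0 := by simpa [gr] using x.2.2
  have heven : evenBlock (x : Queer n) = Matrix.diagonal fun i => epsilon i x :=
    x.2.1.1.diagonal_diag.symm
  have key {Y : Matrix (Fin n) (Fin n) ℂ} (hY : ∀ i j, root i j ≠ α → Y i j = 0) :
      Matrix.diagonal (fun i => epsilon i x) * Y - Y * Matrix.diagonal (fun i => epsilon i x) =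
        α x • Y := by
    ext i j
    rw [Matrix.sub_apply, Matrix.diagonal_mul, Matrix.mul_diagonal, Matrix.smul_apply, smul_eq_mul]
    by_cases hij : root i j = α
    · rw [← hij, LinearMap.sub_apply]
      ring
    · rw [hY i j hij]
      ring
  change superBracket (x : Queer n) y = α x • y
  apply ext_blocks
  · simpa [hodd, heven] using key fun i j hij => (h i j hij).1
  · simpa [hodd, heven] using key fun i j hij => (h i j hij).2

theorem isRootVector_unitE (s : ZMod 2) (i j : Fin n) : IsRootVector (root i j) (unitE s i j) :=
  isRootVector_of_support fun a b hab =>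
    blocks_unitE_eq_zero s (by rintro ⟨rfl, rfl⟩; exact hab rfl)

theorem isRootVector_of_mem_cartan {x : Queer n} (hx : x ∈ cartan n) : IsRootVector 0 x := by
  refine isRootVector_of_support fun i j hij => ?_
  have hne : i ≠ j := by
    rintro rfl
    exact hij (sub_self _)
  exact ⟨hx.1 hne, hx.2 hne⟩

theorem bracket_evenE_evenE (i j : Fin n) :
    bracket (evenE i j) (evenE j i) = ((kEven i - kEven j : cartanEven n) : Queer n) := by
  change superBracket (evenE i j) (evenE j i) = evenE i i - evenE j j
  exact ext_blocks (by simp [evenE]) (by simp [evenE])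

theorem root_kEven_sub_kEven (hij : i ≠ j) : root i j (kEven i - kEven j) = 2 := by
  rw [map_sub (root i j), LinearMap.sub_apply, LinearMap.sub_apply]
  simp only [epsilon_kEven, if_true, if_neg hij, if_neg hij.symm]
  norm_num

theorem bracket_evenE_iterate_three (hij : i ≠ j) (x : Queer n) :
    bracket (evenE i j) (bracket (evenE i j) (bracket (evenE i j) x)) = 0 := by
  change superBracket _ (superBracket _ (superBracket _ x)) = 0
  have hE : Matrix.single i j (1 : ℂ) * Matrix.single i j 1 = 0 :=
    Matrix.single_mul_single_of_ne _ _ _ _ hij.symm _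
  have heven : evenBlock (evenE i j) = Matrix.single i j (1 : ℂ) := rfl
  have hodd : oddBlock (evenE i j) = 0 := rfl
  generalize Matrix.single i j (1 : ℂ) = E at hE heven
  have hE' (X : Matrix (Fin n) (Fin n) ℂ) : X * E * E = 0 := by rw [mul_assoc, hE, mul_zero]
  apply ext_blocks <;> simp [heven, hodd, mul_sub, sub_mul, ← mul_assoc, hE, hE']

end Queer

/-! ### Sums of weight spaces -/

section Weights

variable {n : ℕ} {A : Type v} [CommRing A] [Algebra ℂ A]

theorem currentAlgebra_bracket_tmul (x y : Queer n) (a b : A) :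
    (currentAlgebra (Queer n) A).bracket (x ⊗ₜ a) (y ⊗ₜ b) = bracket x y ⊗ₜ (a * b) := rfl

theorem tmul_mem_gr {i : ZMod 2} {x : Queer n} (hx : x ∈ (gr i : Submodule ℂ (Queer n))) (a : A) :
    x ⊗ₜ a ∈ (currentAlgebra (Queer n) A).gr i :=
  ⟨(⟨x, hx⟩ : (gr i : Submodule ℂ (Queer n))) ⊗ₜ a, rfl⟩

theorem tmul_mem_cartanCurrent {x : Queer n} (hx : x ∈ cartan n) (a : A) :
    x ⊗ₜ a ∈ cartanCurrent n A :=
  ⟨(⟨x, hx⟩ : cartan n) ⊗ₜ a, rfl⟩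

theorem lie_ι_incl {y : Queer n} (hy : y ∈ (gr 0 : Submodule ℂ (Queer n))) (x : Queer n) :
    ⁅(Env.ι (incl n A y) : Env (Current n A)), Env.ι (incl n A x)⁆ =
      Env.ι (incl n A (bracket y x)) := by
  rw [Env.lie_ι_of_even (incl_even A 0 y hy), incl_bracket]

theorem tmul_mem_span_of_mem_span {S : Set (Queer n)} {T : Set (Current n A)} {a : A}
    (h : ∀ y ∈ S, y ⊗ₜ a ∈ Submodule.span ℂ T) {x : Queer n} (hx : x ∈ Submodule.span ℂ S) :
    x ⊗ₜ a ∈ Submodule.span ℂ T :=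
  (Submodule.span_le (p := (Submodule.span ℂ T).comap
    ((TensorProduct.mk ℂ (Queer n) A).flip a))).2 h hx

variable (n A) in
/-- The spanning set of `(h ⊕ n⁻) ⊗ A` given by the matrix units on and below the diagonal. -/
def lowerUnits : Set (Current n A) := {y | ∃ s i j a, j ≤ i ∧ y = unitE s i j ⊗ₜ a}

theorem exists_mem_gr_of_mem_lowerUnits {y : Current n A} (hy : y ∈ lowerUnits n A) :
    ∃ i, y ∈ (currentAlgebra (Queer n) A).gr i := by
  obtain ⟨s, i, j, a, _, rfl⟩ := hy
  exact ⟨s, tmul_mem_gr (unitE_mem_gr s i j) a⟩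

theorem span_lowerUnits_union_nPlus :
    Submodule.span ℂ (lowerUnits n A ∪ {y | ∃ x ∈ nPlus n, ∃ a, y = x ⊗ₜ a}) = ⊤ := by
  refine eq_top_iff.2 fun y _ => ?_
  induction y using TensorProduct.induction_on with
  | zero => exact zero_mem _
  | add x y hx hy => exact add_mem (hx trivial) (hy trivial)
  | tmul x a =>
    refine tmul_mem_span_of_mem_span ?_ (mem_span_unitE (p := fun _ _ => True) (by simp))
    rintro _ ⟨s, i, j, -, rfl⟩
    refine Submodule.subset_span ?_
    rcases lt_or_ge i j with h | h
    · exact .inr ⟨_, unitE_mem_nPlus s h, a, rfl⟩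
    · exact .inl ⟨s, i, j, a, h, rfl⟩

variable {M : Type u} [AddCommGroup M] [Module ℂ M] [Module (Env (Current n A)) M]
  [IsScalarTower ℂ (Env (Current n A)) M] {α μ : Module.Dual ℂ (cartanEven n)}
  {S S' : Set (Module.Dual ℂ (cartanEven n))} {m : M}

theorem ι_smul_mem_weightSpace {y : Queer n} (hy : IsRootVector α y) (a : A)
    (hm : m ∈ weightSpace A M μ) :
    (Env.ι (y ⊗ₜ a) : Env (Current n A)) • m ∈ weightSpace A M (μ + α) := by
  intro h
  have hhm := hm h
  rw [incl_apply] at hhm ⊢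
  rw [ι_smul_ι_smul_of_even (tmul_mem_gr h.2.2 1), currentAlgebra_bracket_tmul, one_mul, hy h,
    ← TensorProduct.smul_tmul', map_smul, smul_assoc, hhm, smul_comm (Env.ι _), ← add_smul,
    add_comm, LinearMap.add_apply]

theorem ι_smul_mem_weightSpace_of_cartanCurrent {y : Current n A} (hy : y ∈ cartanCurrent n A)
    (hm : m ∈ weightSpace A M μ) :
    (Env.ι y : Env (Current n A)) • m ∈ weightSpace A M μ := by
  obtain ⟨z, rfl⟩ := hy
  induction z using TensorProduct.induction_on with
  | zero => simp
  | add x y hx hy => rw [map_add, map_add, add_smul]; exact add_mem hx hy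
  | tmul x a => simpa using ι_smul_mem_weightSpace (isRootVector_of_mem_cartan x.2) a hm

variable (A M) in
theorem iSupIndep_weightSpace :
    iSupIndep fun μ : Module.Dual ℂ (cartanEven n) => weightSpace A M μ := by
  let f : cartanEven n → Module.End ℂ M :=
    fun h => Algebra.lsmul ℂ ℂ M (Env.ι (incl n A h) : Env (Current n A))
  have hcomm (h h' : cartanEven n) : Commute (f h) (f h') := LinearMap.ext fun m => by
    change Env.ι (incl n A h) • Env.ι (incl n A h') • m =
      Env.ι (incl n A h') • Env.ι (incl n A h) • m
    rw [incl_apply, incl_apply, ι_smul_ι_smul_of_even (tmul_mem_gr h.2.2 1),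
      currentAlgebra_bracket_tmul, isRootVector_of_mem_cartan h'.2.1 h, LinearMap.zero_apply,
      zero_smul, TensorProduct.zero_tmul, map_zero, zero_smul, zero_add]
  have hindep := Module.End.independent_iInf_maxGenEigenspace_of_forall_mapsTo f
    fun i j c => Module.End.mapsTo_maxGenEigenspace_of_comm (hcomm j i) c
  refine (hindep.comp (f := fun μ : Module.Dual ℂ (cartanEven n) => (μ : cartanEven n → ℂ))
    DFunLike.coe_injective).mono fun μ m hm => Submodule.mem_iInf _ |>.2 fun h => ?_
  exact Module.End.eigenspace_le_maxGenEigenspace (Module.End.mem_eigenspace_iff.2 (hm h))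

variable (A M) in
/-- The sum of the weight spaces of `M` for the weights in `S`. -/
def weightSum (S : Set (Module.Dual ℂ (cartanEven n))) : Submodule ℂ M :=
  ⨆ μ ∈ S, weightSpace A M μ

theorem mem_weightSum (hμ : μ ∈ S) (hm : m ∈ weightSpace A M μ) : m ∈ weightSum A M S :=
  le_iSup₂ (f := fun μ (_ : μ ∈ S) => weightSpace A M μ) μ hμ hm

theorem disjoint_weightSum (h : Disjoint S S') : Disjoint (weightSum A M S) (weightSum A M S') :=
  (iSupIndep_weightSpace A M).disjoint_biSup_biSup h

theorem eq_zero_of_mem_weightSum (hμ : μ ∉ S) (hm : m ∈ weightSpace A M μ)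
    (hmS : m ∈ weightSum A M S) : m = 0 :=
  Submodule.disjoint_def.1 (disjoint_weightSum (Set.disjoint_singleton_left.2 hμ)) m
    (mem_weightSum (Set.mem_singleton μ) hm) hmS

theorem ι_smul_mem_weightSum (hS : ∀ μ ∈ S, μ + α ∈ S') {y : Queer n} (hy : IsRootVector α y)
    (a : A) (hm : m ∈ weightSum A M S) :
    (Env.ι (y ⊗ₜ a) : Env (Current n A)) • m ∈ weightSum A M S' := by
  have hle : weightSum A M S ≤ (weightSum A M S').comap
      (Algebra.lsmul ℂ ℂ M (Env.ι (y ⊗ₜ a) : Env (Current n A)) : M →ₗ[ℂ] M) :=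
    iSup₂_le fun μ hμ m hm => mem_weightSum (hS μ hμ) (ι_smul_mem_weightSpace hy a hm)
  exact hle hm

end Weights

/-! ### The weight space of the highest weight -/

section HighestWeightVectors

variable {n : ℕ} {A : Type v} [CommRing A] [Algebra ℂ A] {M : Type u} [AddCommGroup M]
  [Module ℂ M] [Module (Env (Current n A)) M] [IsScalarTower ℂ (Env (Current n A)) M]
  {lam : Module.Dual ℂ (cartanEven n)} {X : Set M} {m w : M}

variable (A) in
/-- `w` is a highest weight vector of weight `λ` for `q(n) ⊗ A`: it has weight `λ` and is killed by
`n⁺ ⊗ A`. The zero vector is allowed. -/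
structure IsHighestWeightVector (lam : Module.Dual ℂ (cartanEven n)) (w : M) : Prop where
  nPlus : ∀ x ∈ nPlus n, ∀ a : A, (Env.ι (x ⊗ₜ a) : Env (Current n A)) • w = 0
  mem_weightSpace : w ∈ weightSpace A M lam

theorem WeylRel.isHighestWeightVector (h : WeylRel A lam w) : IsHighestWeightVector A lam w :=
  ⟨h.nPlus, h.weight⟩

theorem mem_of_mem_span_of_isHighestWeightVector (hX : ∀ x ∈ X, IsHighestWeightVector A lam x)
    {N : Submodule ℂ M} (hXN : X ⊆ N)
    (hN : ∀ y ∈ lowerUnits n A, ∀ m ∈ N, (Env.ι y : Env (Current n A)) • m ∈ N)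
    (hm : m ∈ Submodule.span (Env (Current n A)) X) : m ∈ N := by
  refine mem_of_mem_span_of_triangular (fun y => exists_mem_gr_of_mem_lowerUnits)
    span_lowerUnits_union_nPlus ?_ hXN hN hm
  rintro _ ⟨x, hx, a, rfl⟩ w hw
  exact (hX w hw).nPlus x hx a

theorem mem_weightSum_weightsBelow_of_mem_span (hX : ∀ x ∈ X, IsHighestWeightVector A lam x)
    (hm : m ∈ Submodule.span (Env (Current n A)) X) : m ∈ weightSum A M (weightsBelow lam) := by
  refine mem_of_mem_span_of_isHighestWeightVector hX
    (fun x hx => mem_weightSum (self_mem_weightsBelow lam) (hX x hx).mem_weightSpace) ?_ hm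
  rintro _ ⟨s, i, j, a, hij, rfl⟩ m hm
  exact ι_smul_mem_weightSum (fun μ hμ => add_root_mem_weightsBelow hμ hij)
    (isRootVector_unitE s i j) a hm

theorem ι_smul_mem_sup_weightSum {N : Submodule ℂ M} (hN : N ≤ weightSpace A M lam)
    (hcartan : ∀ y ∈ cartanCurrent n A, ∀ m ∈ N, (Env.ι y : Env (Current n A)) • m ∈ N)
    {y : Current n A} (hy : y ∈ lowerUnits n A)
    (hm : m ∈ N ⊔ weightSum A M (weightsBelow lam \ {lam})) :
    (Env.ι y : Env (Current n A)) • m ∈ N ⊔ weightSum A M (weightsBelow lam \ {lam}) := by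
  obtain ⟨s, i, j, a, hij, rfl⟩ := hy
  obtain ⟨u, hu, v, hv, rfl⟩ := Submodule.mem_sup.1 hm
  rw [smul_add]
  rcases hij.eq_or_lt with rfl | hij
  · have hcart := unitE_self_mem_cartan s j
    refine Submodule.add_mem_sup (hcartan _ (tmul_mem_cartanCurrent hcart a) u hu)
      (ι_smul_mem_weightSum (fun μ hμ => ?_) (isRootVector_of_mem_cartan hcart) a hv)
    rwa [add_zero]
  · have below {μ} (hμ : μ ∈ weightsBelow lam) : μ + root i j ∈ weightsBelow lam \ {lam} :=
      ⟨add_root_mem_weightsBelow hμ hij.le, add_root_ne_of_mem_weightsBelow hμ hij⟩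
    exact Submodule.mem_sup_right <| add_mem
      (mem_weightSum (below (self_mem_weightsBelow lam))
        (ι_smul_mem_weightSpace (isRootVector_unitE s i j) a (hN hu)))
      (ι_smul_mem_weightSum (fun μ hμ => below hμ.1) (isRootVector_unitE s i j) a hv)

theorem mem_of_mem_weightSpace_of_mem_span (hX : ∀ x ∈ X, IsHighestWeightVector A lam x)
    {N : Submodule ℂ M} (hN : N ≤ weightSpace A M lam) (hXN : X ⊆ N)
    (hcartan : ∀ y ∈ cartanCurrent n A, ∀ m ∈ N, (Env.ι y : Env (Current n A)) • m ∈ N)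
    (hm : m ∈ Submodule.span (Env (Current n A)) X) (hlam : m ∈ weightSpace A M lam) :
    m ∈ N := by
  obtain ⟨u, hu, v, hv, rfl⟩ := Submodule.mem_sup.1 <|
    mem_of_mem_span_of_isHighestWeightVector hX (hXN.trans (SetLike.coe_subset_coe.2 le_sup_left))
      (fun y hy m => ι_smul_mem_sup_weightSum hN hcartan hy) hm
  have hvlam : v ∈ weightSpace A M lam := by simpa using sub_mem hlam (hN hu)
  rwa [eq_zero_of_mem_weightSum (fun h => h.2 rfl) hvlam hv, add_zero]

theorem ι_tmul_smul_mem_weightSum_of_mem_nPlus {x : Queer n} (hx : x ∈ nPlus n) (a : A)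
    (hw : w ∈ weightSpace A M lam) :
    (Env.ι (x ⊗ₜ a) : Env (Current n A)) • w ∈ weightSum A M (weightsBelow lam)ᶜ := by
  have hxa : x ⊗ₜ a ∈ Submodule.span ℂ {y | ∃ s i j, i < j ∧ y = unitE s i j ⊗ₜ[ℂ] a} := by
    refine tmul_mem_span_of_mem_span ?_
      (mem_span_unitE (p := (· < ·)) fun i j hij => hx i j (not_lt.1 hij))
    rintro _ ⟨s, i, j, hij, rfl⟩
    exact Submodule.subset_span ⟨s, i, j, hij, rfl⟩
  refine ι_smul_mem_of_mem_span ?_ hxa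
  rintro _ ⟨s, i, j, hij, rfl⟩
  exact mem_weightSum (add_root_notMem_weightsBelow lam hij)
    (ι_smul_mem_weightSpace (isRootVector_unitE s i j) a hw)

theorem isHighestWeightVector_of_mem_span (hX : ∀ x ∈ X, IsHighestWeightVector A lam x)
    (hspan : Submodule.span (Env (Current n A)) X = ⊤) (hw : w ∈ weightSpace A M lam) :
    IsHighestWeightVector A lam w := by
  refine ⟨fun x hx a => ?_, hw⟩
  exact Submodule.disjoint_def.1 (disjoint_weightSum disjoint_compl_right) _
    (mem_weightSum_weightsBelow_of_mem_span hX (hspan ▸ Submodule.mem_top))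
    (ι_tmul_smul_mem_weightSum_of_mem_nPlus hx a hw)

theorem mem_maxGenEigenspace_evenE_of_mem_span {i j : Fin n} (hij : i ≠ j)
    (hX : X ⊆ (Algebra.lsmul ℂ ℂ M
      (Env.ι (evenE i j ⊗ₜ 1) : Env (Current n A))).maxGenEigenspace 0)
    (hm : m ∈ Submodule.span (Env (Current n A)) X) :
    m ∈ (Algebra.lsmul ℂ ℂ M
      (Env.ι (evenE i j ⊗ₜ 1) : Env (Current n A))).maxGenEigenspace 0 := by
  refine mem_of_mem_span_of_ι_smul_mem hX (fun y m hm => ?_) hm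
  refine ι_smul_mem_maxGenEigenspace_zero (k := 3) (tmul_mem_gr (evenE_mem_gr i j) 1) ?_ hm
  induction y using TensorProduct.induction_on with
  | zero => rw [map_zero]
  | add a b ha hb => rw [map_add, ha, hb, add_zero]
  | tmul x a =>
    simp only [pow_succ, pow_zero, one_mul, Module.End.mul_apply, currentAlgebra_bracket_tmul,
      bracket_evenE_iterate_three hij, TensorProduct.zero_tmul]

theorem IsHighestWeightVector.evenE_pow_smul_eq_zero (hw : IsHighestWeightVector A lam w)
    {i j : Fin n} (hij : i < j) {d : ℕ} (hd : lam (kEven i) - lam (kEven j) = d)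
    (hf : w ∈ (Algebra.lsmul ℂ ℂ M
      (Env.ι (evenE j i ⊗ₜ 1) : Env (Current n A))).maxGenEigenspace 0) :
    (Env.ι (evenE j i ⊗ₜ 1) : Env (Current n A)) ^ (d + 1) • w = 0 := by
  let h : cartanEven n := kEven i - kEven j
  have hroot : root j i = -root i j := (neg_sub _ _).symm
  refine pow_succ_smul_eq_zero_of_primitive (R := ℂ) (h := Env.ι (incl n A h))
    (e := Env.ι (incl n A (evenE i j))) (f := Env.ι (incl n A (evenE j i))) ?_ ?_ ?_ ?_
    (hw.nPlus _ (unitE_mem_nPlus 0 hij) 1) hf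
  · rw [lie_ι_incl (evenE_mem_gr i j), bracket_evenE_evenE]
  · rw [lie_ι_incl h.2.2, ← unitE_zero, isRootVector_unitE, root_kEven_sub_kEven hij.ne, map_smul,
      map_smul, ofNat_smul_eq_nsmul]
  · rw [lie_ι_incl h.2.2, ← unitE_zero, isRootVector_unitE, hroot,
      LinearMap.neg_apply, root_kEven_sub_kEven hij.ne, map_smul, map_smul, neg_smul,
      ofNat_smul_eq_nsmul]
  · rw [← hd, ← map_sub lam]
    exact hw.mem_weightSpace h

end HighestWeightVectors

/-! ### Presentations -/

section Presentation

variable {n : ℕ} {A : Type v} [CommRing A] [Algebra ℂ A] {lam : Module.Dual ℂ (cartanEven n)}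

section Generators

variable {W : Type u} [AddCommGroup W] [Module ℂ W] [Module (Env (Current n A)) W]
  [IsScalarTower ℂ (Env (Current n A)) W] {X : Set W}

theorem weylRel_of_mem_weightSpace (hX : Submodule.span (Env (Current n A)) X = ⊤)
    (hrel : ∀ x ∈ X, WeylRel A lam x) {w : W} (hw : w ∈ weightSpace A W lam) :
    WeylRel A lam w := by
  have hw' : IsHighestWeightVector A lam w :=
    isHighestWeightVector_of_mem_span (fun x hx => (hrel x hx).isHighestWeightVector) hX hw
  refine ⟨hw'.nPlus, hw, fun i j hij d hd => ?_⟩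
  have hlt : i < j := Fin.lt_def.2 (by omega)
  refine hw'.evenE_pow_smul_eq_zero hlt hd <|
    mem_maxGenEigenspace_evenE_of_mem_span hlt.ne' (fun x hx => ?_) (hX ▸ Submodule.mem_top)
  refine (Module.End.mem_maxGenEigenspace _ _ _).2 ⟨d + 1, ?_⟩
  rw [zero_smul, sub_zero, ← map_pow]
  exact (hrel x hx).lower i j hij d hd

theorem span_weightSpace (hX : Submodule.span (Env (Current n A)) X = ⊤)
    (hrel : ∀ x ∈ X, WeylRel A lam x) :
    Submodule.span (Env (Current n A)) (weightSpace A W lam : Set W) = ⊤ :=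
  eq_top_iff.2 <| hX.ge.trans <| Submodule.span_mono fun x hx => (hrel x hx).weight

theorem eqOn_weightSpace (hX : Submodule.span (Env (Current n A)) X = ⊤)
    (hrel : ∀ x ∈ X, IsHighestWeightVector A lam x) {M : Type w} [AddCommGroup M] [Module ℂ M]
    [Module (Env (Current n A)) M] [IsScalarTower ℂ (Env (Current n A)) M]
    {φ : weightSpace A W lam →ₗ[ℂ] M}
    (hφ : ∀ y ∈ cartanCurrent n A, ∀ m m' : weightSpace A W lam,
      (Env.ι y : Env (Current n A)) • (m : W) = m' →
      (Env.ι y : Env (Current n A)) • φ m = φ m')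
    {Φ : W →ₗ[Env (Current n A)] M}
    (hΦ : ∀ m : weightSpace A W lam, (m : W) ∈ X → Φ m = φ m) (m : weightSpace A W lam) :
    Φ m = φ m := by
  let N : Submodule ℂ W :=
    (LinearMap.eqLocus (Φ.restrictScalars ℂ ∘ₗ (weightSpace A W lam).subtype) φ).map
      (weightSpace A W lam).subtype
  have mem_N {w : W} : w ∈ N ↔ ∃ hw : w ∈ weightSpace A W lam, Φ w = φ ⟨w, hw⟩ := by
    simp [N]
  refine (mem_N.1 (mem_of_mem_weightSpace_of_mem_span hrel (N := N) (Submodule.map_subtype_le _ _)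
    (fun x hx => mem_N.2 ⟨(hrel x hx).mem_weightSpace, hΦ ⟨x, _⟩ hx⟩) ?_
    (hX ▸ Submodule.mem_top) m.2)).2
  intro y hy m hm
  obtain ⟨hmw, hm⟩ := mem_N.1 hm
  refine mem_N.2 ⟨ι_smul_mem_weightSpace_of_cartanCurrent hy hmw, ?_⟩
  rw [← hφ y hy ⟨m, hmw⟩ _ rfl, ← hm, map_smul]

end Generators

variable {V : Type u} [AddCommGroup V] [Module ℂ V] [SuperSpace V]
  {act : Current n A → V → V → Prop} {W : Type (max u v)} [AddCommGroup W] [Module ℂ W]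
  [Module (Env (Current n A)) W] [IsScalarTower ℂ (Env (Current n A)) W] [SuperSpace W]
  [IsSuperModule (Current n A) W] {j : V →ₗ[ℂ] W}

theorem isWeylPresentation_of_exists (heven : IsEvenMap j)
    (hspan : Submodule.span (Env (Current n A)) (Set.range j) = ⊤)
    (hact : ∀ y v v', act y v v' → (Env.ι y : Env (Current n A)) • j v = j v')
    (hrel : ∀ v, WeylRel A lam (j v))
    (hex : ∀ (M : Type w) [AddCommGroup M] [Module ℂ M] [Module (Env (Current n A)) M]
      [IsScalarTower ℂ (Env (Current n A)) M] (φ : V →ₗ[ℂ] M),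
      (∀ y v v', act y v v' → (Env.ι y : Env (Current n A)) • φ v = φ v') →
      (∀ v, WeylRel A lam (φ v)) →
      ∃ Φ : W →ₗ[Env (Current n A)] M, ∀ v, Φ (j v) = φ v) :
    IsWeylPresentation.{u, v, w} A lam act j := by
  refine ⟨heven, hspan, hact, hrel, fun M _ _ _ _ _ _ φ hφ hactφ hrelφ => ?_⟩
  obtain ⟨Φ, hΦ⟩ := hex M φ hactφ hrelφ
  refine ⟨Φ, ⟨isEvenMap_of_span Φ hspan ?_, hΦ⟩, fun Φ' hΦ' => ?_⟩
  · rintro _ ⟨v, rfl⟩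
    rw [hΦ, parity_map hφ, parity_map heven, hΦ]
  · exact LinearMap.ext_on_range hspan fun v => (hΦ'.2 v).trans (hΦ v).symm

theorem IsWeylPresentation.weightSpace_subtype (h : IsWeylPresentation.{u, v, w} A lam act j)
    (hcartan : ∀ y v v', act y v v' → y ∈ cartanCurrent n A) :
    IsWeylPresentation.{max u v, v, w} A lam
      (fun y (m m' : weightSpace A W lam) => y ∈ cartanCurrent n A ∧
        (Env.ι y : Env (Current n A)) • (m : W) = m')
      (weightSpace A W lam).subtype := by
  have hrel : ∀ x ∈ Set.range j, WeylRel A lam x := Set.forall_mem_range.2 h.rel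
  have hspan : Submodule.span (Env (Current n A)) (Set.range (weightSpace A W lam).subtype) = ⊤ :=
    (congrArg _ Subtype.range_coe).trans (span_weightSpace h.span_eq_top hrel)
  refine ⟨fun _ _ hx => hx, hspan, fun _ _ _ hy => hy.2,
    fun m => weylRel_of_mem_weightSpace h.span_eq_top hrel m.2, ?_⟩
  intro M _ _ _ _ _ _ φ heven hact hφ
  obtain ⟨Φ, ⟨hΦ, hΦφ⟩, -⟩ := h.existsUnique M
    (φ ∘ₗ LinearMap.codRestrict _ j fun v => (h.rel v).weight)
    (fun i v hv => heven i _ (h.even i v hv))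
    (fun y v v' hv => hact _ _ _ ⟨hcartan y v v' hv, h.smul_eq y v v' hv⟩) (fun v => hφ _)
  have hext : ∀ m : weightSpace A W lam, Φ m = φ m := by
    refine eqOn_weightSpace h.span_eq_top (fun x hx => (hrel x hx).isHighestWeightVector)
      (fun y hy m m' hm => hact y m m' ⟨hy, hm⟩) ?_
    rintro ⟨_, hm⟩ ⟨v, rfl⟩
    exact hΦφ v
  exact ⟨Φ, ⟨hΦ, hext⟩, fun Φ' hΦ' =>
    LinearMap.ext_on_range hspan fun m => (hΦ'.2 m).trans (hext m).symm⟩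

end Presentation

section Truncation

variable {n : ℕ} {A : Type v} [CommRing A] [Algebra ℂ A] {lam : Module.Dual ℂ (cartanEven n)}
  {P : Type u} [AddCommGroup P] [Module ℂ P] [Module (Env (Current n A)) P]
  [IsScalarTower ℂ (Env (Current n A)) P]

theorem weightSum_le_truncSub :
    weightSum A P (weightsBelow lam)ᶜ ≤ (truncSub A P lam).restrictScalars ℂ :=
  iSup₂_le fun μ hμ _ hp => Submodule.subset_span ⟨μ, hμ, hp⟩

theorem weylRel_mkQ_truncSub {p : P} (hp : p ∈ weightSpace A P lam)
    (hlower : ∀ i j : Fin n, (j : ℕ) = i + 1 → ∀ d : ℕ, lam (kEven i) - lam (kEven j) = d →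
      (Env.ι (evenE j i ⊗ₜ 1) : Env (Current n A)) ^ (d + 1) • p = 0) :
    WeylRel A lam ((truncSub A P lam).mkQ p) where
  nPlus _ hx a := (Submodule.Quotient.mk_eq_zero _).2 <|
    weightSum_le_truncSub (ι_tmul_smul_mem_weightSum_of_mem_nPlus hx a hp)
  weight h := congrArg (truncSub A P lam).mkQ (hp h)
  lower i j hij d hd := congrArg (truncSub A P lam).mkQ (hlower i j hij d hd)

theorem truncSub_le_ker {M : Type w} [AddCommGroup M] [Module ℂ M]
    [Module (Env (Current n A)) M] [IsScalarTower ℂ (Env (Current n A)) M]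
    (Ψ : P →ₗ[Env (Current n A)] M) {X : Set P}
    (hX : Submodule.span (Env (Current n A)) X = ⊤)
    (hΨ : ∀ x ∈ X, IsHighestWeightVector A lam (Ψ x)) :
    truncSub A P lam ≤ LinearMap.ker Ψ := by
  have hrange (p : P) : Ψ p ∈ weightSum A M (weightsBelow lam) := by
    refine mem_weightSum_weightsBelow_of_mem_span (X := Ψ '' X) (Set.forall_mem_image.2 hΨ) ?_
    rw [← Submodule.map_span, hX]
    exact Submodule.mem_map_of_mem Submodule.mem_top
  refine Submodule.span_le.2 ?_
  rintro p ⟨μ, hμ, hp⟩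
  refine eq_zero_of_mem_weightSum (μ := μ) hμ (fun h => ?_) (hrange p)
  rw [← map_smul, hp h]
  exact map_smul (Ψ.restrictScalars ℂ) _ _

end Truncation

/-! ### Generators and relations of `W_A(λ)` -/

section FreeModQuotient

variable {g : Type u} [AddCommGroup g] [Module ℂ g] [LieSuperalgebra g] {V : Type v}
  [AddCommGroup V] [Module ℂ V]

theorem mkQ_tmul (N : Submodule (Env g) (FreeMod g V)) (a : Env g) (v : V) :
    N.mkQ (a ⊗ₜ v) = a • N.mkQ (1 ⊗ₜ v) := by
  rw [← map_smul, TensorProduct.smul_tmul', smul_eq_mul, mul_one]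

theorem eq_top_of_mkQ_one_tmul_mem (N : Submodule (Env g) (FreeMod g V))
    {S : Submodule (Env g) (FreeMod g V ⧸ N)} (hS : ∀ v, N.mkQ (1 ⊗ₜ v) ∈ S) : S = ⊤ := by
  refine eq_top_iff.2 fun p _ => ?_
  obtain ⟨t, rfl⟩ := N.mkQ_surjective p
  induction t using TensorProduct.induction_on with
  | zero => exact zero_mem _
  | add a b ha hb => rw [map_add]; exact add_mem (ha trivial) (hb trivial)
  | tmul a v => rw [mkQ_tmul]; exact S.smul_mem a (hS v)

theorem one_tmul_mem_gr [SuperSpace V] {i : ZMod 2} {v : V} (hv : v ∈ (gr i : Submodule ℂ V)) :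
    (1 ⊗ₜ v : FreeMod g V) ∈ (gr i : Submodule ℂ (FreeMod g V)) := by
  rw [mem_gr_iff, parity_tmul, map_one, parity_of_mem hv, TensorProduct.tmul_smul]

end FreeModQuotient

section Lbar

variable {n : ℕ} {L : Type u} [AddCommGroup L] [Module ℂ L] [Module (Env (Queer n)) L]
  [IsScalarTower ℂ (Env (Queer n)) L] {lam : Module.Dual ℂ (cartanEven n)}

theorem mkQ_lbarSub_of_rel {t : FreeMod (Queer n) (queerWeightSpace L lam)}
    (ht : LbarRel L lam t) : (lbarSub L lam).mkQ t = 0 :=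
  (Submodule.Quotient.mk_eq_zero _).2 (Submodule.subset_span ht)

theorem span_range_lbarGen :
    Submodule.span (Env (Queer n)) (Set.range (lbarGen L lam)) = ⊤ :=
  eq_top_of_mkQ_one_tmul_mem _ fun k => Submodule.subset_span ⟨k, rfl⟩

theorem ι_smul_lbarGen_of_mem_cartan {x : Queer n} (hx : x ∈ cartan n)
    {k k' : queerWeightSpace L lam} (hk : (Env.ι x : Env (Queer n)) • (k : L) = k') :
    (Env.ι x : Env (Queer n)) • lbarGen L lam k = lbarGen L lam k' := by
  refine (mkQ_tmul _ _ _).symm.trans (sub_eq_zero.1 ?_)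
  exact (map_sub _ _ _).symm.trans (mkQ_lbarSub_of_rel (LbarRel.cartan x hx k k' hk))

theorem ι_smul_lbarGen (h : cartanEven n) (k : queerWeightSpace L lam) :
    (Env.ι (h : Queer n) : Env (Queer n)) • lbarGen L lam k = lam h • lbarGen L lam k := by
  rw [ι_smul_lbarGen_of_mem_cartan h.2.1 (k' := lam h • k) (k.2 h), map_smul]

theorem evenE_pow_smul_lbarGen {i j : Fin n} (hij : (j : ℕ) = i + 1) {d : ℕ}
    (hd : lam (kEven i) - lam (kEven j) = d) (k : queerWeightSpace L lam) :
    (Env.ι (evenE j i) : Env (Queer n)) ^ (d + 1) • lbarGen L lam k = 0 :=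
  (mkQ_tmul _ _ _).symm.trans (mkQ_lbarSub_of_rel (LbarRel.lower i j hij d hd k))

theorem exists_lbar_lift {N : Type w} [AddCommGroup N] [Module ℂ N] [Module (Env (Queer n)) N]
    [IsScalarTower ℂ (Env (Queer n)) N] (φ : queerWeightSpace L lam →ₗ[ℂ] N)
    (hφ : ∀ t, LbarRel L lam t → freeLift (Queer n) φ t = 0) :
    ∃ ψ : Lbar L lam →ₗ[Env (Queer n)] N, ∀ k, ψ (lbarGen L lam k) = φ k :=
  ⟨(lbarSub L lam).liftQ (freeLift (Queer n) φ) (Submodule.span_le.2 hφ), fun _ => one_smul _ _⟩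

end Lbar

section Induced

variable {n : ℕ} {A : Type v} [CommRing A] [Algebra ℂ A] {V : Type u} [AddCommGroup V]
  [Module ℂ V] [Module (Env (Queer n)) V]

theorem inducedGen_smul (s : Env (Queer n)) (v : V) :
    inducedGen n A V (s • v) = envIncl n A s • inducedGen n A V v := by
  have h : (inducedSub n A V).mkQ ((1 * envIncl n A s) ⊗ₜ v - 1 ⊗ₜ (s • v)) = 0 :=
    (Submodule.Quotient.mk_eq_zero _).2 (Submodule.subset_span ⟨1, s, v, rfl⟩)
  rw [map_sub, one_mul, mkQ_tmul] at h
  exact (sub_eq_zero.1 h).symm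

theorem ι_tmul_one_smul_inducedGen (x : Queer n) (v : V) :
    (Env.ι (x ⊗ₜ 1) : Env (Current n A)) • inducedGen n A V v =
      inducedGen n A V ((Env.ι x : Env (Queer n)) • v) := by
  rw [inducedGen_smul, envIncl_ι, incl_apply]

theorem span_inducedGen_image {X : Set V} (hX : Submodule.span (Env (Queer n)) X = ⊤) :
    Submodule.span (Env (Current n A)) (inducedGen n A V '' X) = ⊤ := by
  refine eq_top_of_mkQ_one_tmul_mem _ fun v => ?_
  have hv : v ∈ Submodule.span (Env (Queer n)) X := hX ▸ Submodule.mem_top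
  change inducedGen n A V v ∈ _
  induction hv using Submodule.span_induction with
  | mem x hx => exact Submodule.subset_span ⟨x, hx, rfl⟩
  | zero => rw [map_zero]; exact zero_mem _
  | add x y _ _ hx hy => rw [map_add]; exact add_mem hx hy
  | smul s x _ hx => rw [inducedGen_smul]; exact Submodule.smul_mem _ _ hx

theorem exists_induced_lift {M : Type w} [AddCommGroup M] [Module ℂ M]
    [Module (Env (Current n A)) M] [IsScalarTower ℂ (Env (Current n A)) M] (ψ : V →ₗ[ℂ] M)
    (hψ : ∀ s v, ψ (s • v) = envIncl n A s • ψ v) :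
    ∃ Ψ : Induced n A V →ₗ[Env (Current n A)] M, ∀ v, Ψ (inducedGen n A V v) = ψ v := by
  refine ⟨(inducedSub n A V).liftQ (freeLift (Current n A) ψ) (Submodule.span_le.2 ?_),
    fun _ => one_smul _ _⟩
  rintro _ ⟨u, s, v, rfl⟩
  rw [SetLike.mem_coe, LinearMap.mem_ker, map_sub, freeLift_tmul, freeLift_tmul, hψ, mul_smul,
    sub_self]

end Induced

section Weyl

variable {n : ℕ} {A : Type v} [CommRing A] [Algebra ℂ A]
  {L : Type u} [AddCommGroup L] [Module ℂ L] [Module (Env (Queer n)) L]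
  [IsScalarTower ℂ (Env (Queer n)) L] {lam : Module.Dual ℂ (cartanEven n)}

theorem exists_induced_lbar_lift {M : Type w} [AddCommGroup M] [Module ℂ M]
    [Module (Env (Current n A)) M] [IsScalarTower ℂ (Env (Current n A)) M]
    (φ : queerWeightSpace L lam →ₗ[ℂ] M)
    (hact : ∀ x ∈ cartan n, ∀ k k' : queerWeightSpace L lam,
      (Env.ι x : Env (Queer n)) • (k : L) = k' →
      (Env.ι (x ⊗ₜ 1) : Env (Current n A)) • φ k = φ k')
    (hrel : ∀ k, WeylRel A lam (φ k)) :
    ∃ Ψ : Induced n A (Lbar L lam) →ₗ[Env (Current n A)] M,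
      ∀ k, Ψ (inducedGen n A (Lbar L lam) (lbarGen L lam k)) = φ k := by
  let _ : Module (Env (Queer n)) M := Module.compHom M (envIncl n A).toRingHom
  have hsmul (s : Env (Queer n)) (m : M) : s • m = envIncl n A s • m := rfl
  have hι (x : Queer n) (m : M) :
      (Env.ι x : Env (Queer n)) • m = (Env.ι (x ⊗ₜ 1) : Env (Current n A)) • m := by
    rw [hsmul, envIncl_ι, incl_apply]
  have : IsScalarTower ℂ (Env (Queer n)) M :=
    ⟨fun c s m => by rw [hsmul, hsmul, map_smul, smul_assoc]⟩
  obtain ⟨ψ, hψ⟩ := exists_lbar_lift φ <| by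
    rintro _ (⟨x, hx, k, k', hk⟩ | ⟨x, hx, k⟩ | ⟨h, k⟩ | ⟨i, j, hij, d, hd, k⟩)
    · rw [map_sub, freeLift_tmul, freeLift_tmul, one_smul, hι, hact x hx k k' hk, sub_self]
    · rw [freeLift_tmul, hι, (hrel k).nPlus x hx]
    · rw [← TensorProduct.tmul_smul, map_sub, freeLift_tmul, freeLift_tmul, hι, (hrel k).weight,
        one_smul, map_smul, sub_self]
    · rw [freeLift_tmul, hsmul, map_pow, envIncl_ι, incl_apply, (hrel k).lower i j hij d hd]
  obtain ⟨Ψ, hΨ⟩ := exists_induced_lift (A := A) (ψ.restrictScalars ℂ) (map_smul ψ)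
  exact ⟨Ψ, fun k => (hΨ _).trans (hψ k)⟩

variable (A L lam) in
theorem span_range_inducedGen_lbarGen : Submodule.span (Env (Current n A))
    (Set.range fun k => inducedGen n A (Lbar L lam) (lbarGen L lam k)) = ⊤ := by
  rw [Set.range_comp' (inducedGen n A (Lbar L lam)) (lbarGen L lam)]
  exact span_inducedGen_image span_range_lbarGen

theorem weylRel_mkQ_inducedGen_lbarGen (k : queerWeightSpace L lam) :
    WeylRel A lam ((truncSub A (Induced n A (Lbar L lam)) lam).mkQ
      (inducedGen n A (Lbar L lam) (lbarGen L lam k))) := by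
  refine weylRel_mkQ_truncSub (fun h => ?_) fun i j hij d hd => ?_
  · rw [incl_apply, ι_tmul_one_smul_inducedGen, ι_smul_lbarGen, map_smul]
  · rw [← incl_apply, ← envIncl_ι, ← map_pow, ← inducedGen_smul, evenE_pow_smul_lbarGen hij hd,
      map_zero]

variable [SuperSpace L] [IsSuperModule (Queer n) L]

variable (A L lam) in
theorem isEvenMap_weylGen : IsEvenMap (weylGen A L lam) := by
  intro i k hk
  have hlbar : lbarGen L lam k ∈ (gr i : Submodule ℂ (Lbar L lam)) := ⟨_, one_tmul_mem_gr hk, rfl⟩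
  exact ⟨_, ⟨_, one_tmul_mem_gr hlbar, rfl⟩, rfl⟩

variable (A L lam) in
theorem span_range_weylGen :
    Submodule.span (Env (Current n A)) (Set.range (weylGen A L lam)) = ⊤ := by
  have hrange : Set.range (weylGen A L lam) = (truncSub A (Induced n A (Lbar L lam)) lam).mkQ ''
      Set.range fun k => inducedGen n A (Lbar L lam) (lbarGen L lam k) :=
    Set.range_comp (truncSub A (Induced n A (Lbar L lam)) lam).mkQ
      fun k => inducedGen n A (Lbar L lam) (lbarGen L lam k)
  rw [hrange, ← Submodule.map_span, span_range_inducedGen_lbarGen, Submodule.map_top,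
    Submodule.range_mkQ]

theorem isWeylPresentation_weylGen : IsWeylPresentation.{u, v, w} A lam
    (fun y (k k' : queerWeightSpace L lam) => ∃ x ∈ cartan n, y = x ⊗ₜ[ℂ] (1 : A) ∧
      (Env.ι x : Env (Queer n)) • (k : L) = k')
    (weylGen A L lam) := by
  refine isWeylPresentation_of_exists (isEvenMap_weylGen A L lam) (span_range_weylGen A L lam) ?_
    weylRel_mkQ_inducedGen_lbarGen ?_
  · rintro _ k k' ⟨x, hx, rfl, hk⟩
    have hinduced : (Env.ι (x ⊗ₜ 1) : Env (Current n A)) •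
        inducedGen n A (Lbar L lam) (lbarGen L lam k) =
          inducedGen n A (Lbar L lam) (lbarGen L lam k') := by
      rw [ι_tmul_one_smul_inducedGen, ι_smul_lbarGen_of_mem_cartan hx hk]
    exact congrArg (truncSub A (Induced n A (Lbar L lam)) lam).mkQ hinduced
  · intro M _ _ _ _ φ hact hrel
    obtain ⟨Ψ, hΨ⟩ := exists_induced_lbar_lift φ
      (fun x hx k k' hk => hact _ k k' ⟨x, hx, rfl, hk⟩) hrel
    have hker : truncSub A (Induced n A (Lbar L lam)) lam ≤ LinearMap.ker Ψ :=
      truncSub_le_ker Ψ (span_range_inducedGen_lbarGen A L lam) <| Set.forall_mem_range.2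
        fun k => (hΨ k).symm ▸ (hrel k).isHighestWeightVector
    exact ⟨(truncSub A (Induced n A (Lbar L lam)) lam).liftQ Ψ hker, hΨ⟩

end Weyl

end QueerWeyl

theorem proposition3p5_general {n : ℕ} (A : Type v) [CommRing A] [Algebra ℂ A]
    (lam : Module.Dual ℂ (cartanEven n))
    (L : Type u) [AddCommGroup L] [Module ℂ L] [Module (Env (Queer n)) L]
    [IsScalarTower ℂ (Env (Queer n)) L] [SuperSpace L] [IsSuperModule (Queer n) L] :
    Submodule.span (Env (Current n A))
        (weightSpace A (GlobalWeyl A L lam) lam : Set (GlobalWeyl A L lam)) = ⊤ ∧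
      (∀ w ∈ weightSpace A (GlobalWeyl A L lam) lam, WeylRel A lam w) ∧
      (∀ k : queerWeightSpace L lam,
        weylGen A L lam k ∈ weightSpace A (GlobalWeyl A L lam) lam) ∧
      IsWeylPresentation.{u, v, w} A lam
        (fun y (k k' : queerWeightSpace L lam) => ∃ x ∈ cartan n, y = x ⊗ₜ[ℂ] (1 : A) ∧
          (Env.ι x : Env (Queer n)) • (k : L) = k')
        (weylGen A L lam) ∧
      IsWeylPresentation.{max u v, v, w} A lam
        (fun y (m m' : weightSpace A (GlobalWeyl A L lam) lam) =>
          y ∈ cartanCurrent n A ∧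
            (Env.ι y : Env (Current n A)) • (m : GlobalWeyl A L lam) = m')
        (weightSpace A (GlobalWeyl A L lam) lam).subtype := by
  have h : IsWeylPresentation.{u, v, w} A lam _ (weylGen A L lam) := isWeylPresentation_weylGen
  have hrel : ∀ w ∈ Set.range (weylGen A L lam), WeylRel A lam w := Set.forall_mem_range.2 h.rel
  refine ⟨span_weightSpace h.span_eq_top hrel,
    fun w hw => weylRel_of_mem_weightSpace h.span_eq_top hrel hw,
    fun k => (h.rel k).weight, h, h.weightSpace_subtype ?_⟩
  rintro _ k k' ⟨x, hx, rfl, -⟩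
  exact tmul_mem_cartanCurrent hx 1

theorem proposition3p5 {n : ℕ} (hn : 2 ≤ n) (A : Type v) [CommRing A] [Algebra ℂ A]
    (lam : Module.Dual ℂ (cartanEven n)) (hlam : lam ∈ dominantWeights n)
    (L : Type u) [AddCommGroup L] [Module ℂ L] [Module (Env (Queer n)) L]
    [IsScalarTower ℂ (Env (Queer n)) L] [SuperSpace L] [IsSuperModule (Queer n) L]
    (hL : IsIrreducibleHighestWeight L lam) :
    Submodule.span (Env (Current n A))
        (weightSpace A (GlobalWeyl A L lam) lam : Set (GlobalWeyl A L lam)) = ⊤ ∧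
      (∀ w ∈ weightSpace A (GlobalWeyl A L lam) lam, WeylRel A lam w) ∧
      (∀ k : queerWeightSpace L lam,
        weylGen A L lam k ∈ weightSpace A (GlobalWeyl A L lam) lam) ∧
      IsWeylPresentation.{u, v, w} A lam
        (fun y (k k' : queerWeightSpace L lam) => ∃ x ∈ cartan n, y = x ⊗ₜ[ℂ] (1 : A) ∧
          (Env.ι x : Env (Queer n)) • (k : L) = k')
        (weylGen A L lam) ∧
      IsWeylPresentation.{max u v, v, w} A lam
        (fun y (m m' : weightSpace A (GlobalWeyl A L lam) lam) =>
          y ∈ cartanCurrent n A ∧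
            (Env.ι y : Env (Current n A)) • (m : GlobalWeyl A L lam) = m')
        (weightSpace A (GlobalWeyl A L lam) lam).subtype :=
  proposition3p5_general A lam L
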